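/- Let $X=((X_t)_{t\ge0},(\mathbb P_i)_{i\in S})$ be an irreducible, non-explosive, time-homogeneous continuous-time Markov chain on a finite or countable set $S$, with transition probabilities $p_{ij}(t)$ and conservative $q$-matrix $Q=(q_{ij})$, i.e. $q_{ij}=p_{ij}'(0)$ and $\sum_{j\in S}q_{ij}=0$. Let $D\subset S$, $E=S\setminus D$, $T=\inf\{t\ge 0:X_t\in D\}$, and $E_\Delta=E\cup\{\Delta\}$ with a cemetery $\Delta\notin E$. Let $X^T_t=X_t$ for $t<T$ and $X^T_t=\Delta$ for $t\ge T$. Let $p^T_{ij}(t)=\mathbb P_i(X^T_t=j)$ for $i\in E$, $j\in E_\Delta$, and $p^T_{\Delta j}(t)=1_{\{j=\Delta\}}$. Let $Q^T$ be the matrix on $E_\Delta$ with $q^T_{ij}=q_{ij}$ and $q^T_{i\Delta}=\sum_{k\in D}q_{ik}$ for $i,j\in E$, and $q^T_{\Delta j}=0$ for $j\in E_\Delta$. Write $q^{n,T}_{ij}$ for the entries of $(Q^T)^n$, where $(Q^T)^{n+1}=(Q^T)^nQ^T$. A distribution on $E_\Delta$ is a vector $\mu=(\mu_i)_{i\in E_\Delta}$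 with $\mu_i\ge0$, $\sum_i\mu_i=1$ and $\mu_\Delta=0$; put $\mathbb P_\mu=\sum_{i\in E}\mu_i\mathbb P_i$. A distribution $\nu$ is quasi-stationary if $\mathbb P_\nu(X^T_t=i\mid T>t)=\nu_i$ for all $t\ge0$ and $i\in E_\Delta$. Let $\mu$ be a distribution on $E_\Delta$ and $\alpha>0$ such that $\mathbb P_\mu(T>t)=e^{-\alpha t}$ for all $t\ge0$, and such that, for all $t>0$ and $j\in E_\Delta$, $t\mapsto\sum_i\mu_ip^T_{ij}(t)$ is differentiable with $\frac{d}{dt}\sum_i\mu_ip^T_{ij}(t)=\sum_i\mu_i\frac{d}{dt}p^T_{ij}(t)$, the last series converging. Assume that for all $n\ge0$ and $j\in E$ the double series $\sum_{i,k\in E_\Delta}\mu_i\,q^{n,T}_{ik}\,q^T_{kj}$ converges absolutely, and define $$\mu^{(n)}_j=\frac{(-1)^n}{\alpha^n}\sum_{i\in E_\Delta}\mu_i\,q^{n,T}_{ij}\quad(j\in E),\qquad \mu^{(n)}_\Delta=0 .$$ 1. Let $n\ge1$, and suppose that $\mu^{(m)}$ is a distribution for every $1\le m<n$, or else that $0\le(-1)^m\sum_{i\in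 E_\Delta}\mu_iq^{m,T}_{ij}\le\alpha^m$ for all $m\ge1$ and $j\in E$. If $\mu^{(n)}$ is a quasi-stationary distribution, then $\mu^{(k)}=\mu^{(k+1)}$ for all $k\ge n$. 2. If $\mu^{(n)}$ is a distribution for every $n\ge1$ and $\mu^{(n)}_i\to\mu^{(\infty)}_i$ as $n\to\infty$ for every $i\in E_\Delta$, where $\mu^{(\infty)}$ is a distribution, then $\mu^{(\infty)}$ is quasi-stationary. -/

import Mathlib

open Set Filter Topology MeasureTheory
open scoped NNReal ENNReal

noncomputable section

/-- A path in a discrete state space, defined for all times, that is right-continuous and has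
left limits (for the discrete topology): it jumps finitely often in every bounded time interval. -/
def IsStepPath {S : Type*} (x : ℝ≥0 → S) : Prop :=
  (∀ t : ℝ≥0, ∃ ε : ℝ≥0, 0 < ε ∧ ∀ s, t ≤ s → s < t + ε → x s = x t) ∧
  (∀ t : ℝ≥0, 0 < t → ∃ (l : S) (r : ℝ≥0), r < t ∧ ∀ s, r < s → s < t → x s = l)

/-- A time-homogeneous, non-explosive continuous-time Markov chain `((X_t)_{t ≥ 0}, (P_i)_{i ∈ S})`
on a (countable) discrete state space `S`. Non-explosion is the statement that almost every path is
an `S`-valued step path on the whole of `[0, ∞)`. -/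
structure CTMarkovChain (S Ω : Type*) [MeasurableSpace Ω] where
  /-- the law of the chain started at `i` -/
  P : S → Measure Ω
  /-- the state at time `t` -/
  X : ℝ≥0 → Ω → S
  isProb : ∀ i, IsProbabilityMeasure (P i)
  measurable_state : ∀ t j, MeasurableSet {ω | X t ω = j}
  start : ∀ i, ∀ᵐ ω ∂(P i), X 0 ω = i
  step_paths : ∀ i, ∀ᵐ ω ∂(P i), IsStepPath (fun t => X t ω)
  /-- the Markov property with respect to the natural filtration -/
  markov : ∀ (i : S) (n : ℕ) (u : Fin (n + 1) → ℝ≥0) (x : Fin (n + 1) → S) (s : ℝ≥0) (k : S),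
    Monotone u →
      P i {ω | (∀ m, X (u m) ω = x m) ∧ X (u (Fin.last n) + s) ω = k} =
        P i {ω | ∀ m, X (u m) ω = x m} * P (x (Fin.last n)) {ω | X s ω = k}

namespace CTMarkovChain

variable {S Ω : Type*} [MeasurableSpace Ω] (C : CTMarkovChain S Ω)

/-- The transition probability `p_{ij}(t)` (used for `t ≥ 0` only). -/
def transProb (t : ℝ) (i j : S) : ℝ := (C.P i).real {ω | C.X t.toNNReal ω = j}

/-- `X` is irreducible. -/
def IsIrreducible : Prop := ∀ i j : S, ∃ t : ℝ, 0 < t ∧ 0 < C.transProb t i j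

/-- `q` is the `q`-matrix of the chain: `q_{ij} = p_{ij}'(0)`, a right derivative. -/
def IsQMatrix (q : S → S → ℝ) : Prop :=
  ∀ i j : S, HasDerivWithinAt (fun t => C.transProb t i j) (q i j) (Ici 0) 0

/-- The first passage time `T = inf {t ≥ 0 : X_t ∈ D}`, equal to `∞` if `D` is never visited. -/
def hit (D : Set S) (ω : Ω) : ℝ≥0∞ := ⨅ (t : ℝ≥0) (_ : C.X t ω ∈ D), (t : ℝ≥0∞)

theorem not_mem_of_lt_hit {D : Set S} {ω : Ω} {t : ℝ≥0} (h : (t : ℝ≥0∞) < C.hit D ω) :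
    C.X t ω ∉ D := fun hD => absurd h (not_lt.mpr (iInf₂_le t hD))

/-- The state space `E_Δ = E ∪ {Δ}` with `E = S \ D`; the cemetery `Δ` is `none`. -/
abbrev Killed (D : Set S) : Type _ := Option {i : S // i ∉ D}

open Classical in
/-- The killed process `X^T`. -/
def killed (D : Set S) (t : ℝ≥0) (ω : Ω) : Killed D :=
  if h : (t : ℝ≥0∞) < C.hit D ω then some ⟨C.X t ω, C.not_mem_of_lt_hit h⟩ else none

open Classical in
/-- The transition probability `p^T_{ij}(t)` of the killed process (used for `t ≥ 0` only);
`Δ` is absorbing. -/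
def killedProb (D : Set S) (t : ℝ) : Killed D → Killed D → ℝ
  | some i, j => (C.P i).real {ω | C.killed D t.toNNReal ω = j}
  | none, j => if j = none then 1 else 0

/-- The law `P_μ = ∑_{i ∈ E} μ_i P_i`, for a distribution `μ` on `E_Δ` not charging `Δ`. -/
def initLaw (D : Set S) (μ : Killed D → ℝ) : Measure Ω :=
  Measure.sum fun i : {i : S // i ∉ D} => ENNReal.ofReal (μ (some i)) • C.P i

/-- `P_μ(T > t)`. -/
def survival (D : Set S) (μ : Killed D → ℝ) (t : ℝ≥0) : ℝ :=
  (C.initLaw D μ).real {ω | (t : ℝ≥0∞) < C.hit D ω}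

/-- `μ_i(t) = P_μ(X^T_t = i | T > t)`. -/
def condLaw (D : Set S) (μ : Killed D → ℝ) (t : ℝ≥0) (i : Killed D) : ℝ :=
  (C.initLaw D μ).real {ω | C.killed D t ω = i ∧ (t : ℝ≥0∞) < C.hit D ω} / C.survival D μ t

/-- Under `P_μ` the time `T` is exponentially distributed with parameter `α`. -/
def IsExponential (D : Set S) (μ : Killed D → ℝ) (α : ℝ) : Prop :=
  ∀ t : ℝ≥0, C.survival D μ t = Real.exp (-α * t)

/-- `μ P^T(t)` is differentiable and `d/dt (μ P^T(t)) = μ (d/dt P^T(t))`, `t > 0`, entry by entry. -/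
def DiffCondition (D : Set S) (μ : Killed D → ℝ) : Prop :=
  ∀ (j : Killed D) (t : ℝ), 0 < t →
    Summable (fun i => μ i * deriv (fun s => C.killedProb D s i j) t) ∧
    HasDerivAt (fun s => ∑' i, μ i * C.killedProb D s i j)
      (∑' i, μ i * deriv (fun s => C.killedProb D s i j) t) t

end CTMarkovChain

open CTMarkovChain

/-- A (probability) distribution on `E_Δ` that does not charge `Δ`. -/
def IsDistribution {S : Type*} {D : Set S} (μ : Killed D → ℝ) : Prop :=
  (∀ i, 0 ≤ μ i) ∧ HasSum μ 1 ∧ μ none = 0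

/-- `μ` is a quasi-stationary distribution: `μ_i(t) = μ_i` for all `t ≥ 0` and `i ∈ E_Δ`. -/
def CTMarkovChain.IsQuasiStationary {S Ω : Type*} [MeasurableSpace Ω] (C : CTMarkovChain S Ω)
    (D : Set S) (μ : Killed D → ℝ) : Prop :=
  IsDistribution μ ∧ ∀ (t : ℝ≥0) (i : Killed D), C.condLaw D μ t i = μ i

/-- The `q`-matrix `Q^T` of the killed process; `q^T_{iΔ}` is the killing rate
`η_i = ∑_{j ∈ D} q_{ij}`. -/
def killedQ {S : Type*} (q : S → S → ℝ) (D : Set S) : Killed D → Killed D → ℝ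
  | some i, some j => q i j
  | some i, none => ∑' j : D, q i j
  | none, _ => 0

open Classical in
/-- Powers of a possibly infinite matrix. -/
def matPow {ι : Type*} (A : ι → ι → ℝ) : ℕ → ι → ι → ℝ
  | 0 => fun i j => if i = j then 1 else 0
  | n + 1 => fun i j => ∑' k, matPow A n i k * A k j

/-- For every `n ≥ 0` and `j ∈ E` the double series `∑_{i,k} μ_i q^{n,T}_{ik} q^T_{kj}`, whose value
is `∑_i μ_i q^{n+1,T}_{ij}`, converges absolutely. -/
def PowersConverge {S : Type*} (q : S → S → ℝ) (D : Set S) (μ : Killed D → ℝ) : Prop :=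
  ∀ (n : ℕ) (j : {i : S // i ∉ D}),
    Summable fun p : Killed D × Killed D =>
      μ p.1 * matPow (killedQ q D) n p.1 p.2 * killedQ q D p.2 (some j)

/-- `μ^{(n)}_j = ((-1)^n / α^n) ∑_{i ∈ E_Δ} μ_i q^{n,T}_{ij}` for `j ∈ E`, and `μ^{(n)}_Δ = 0`. -/
def muSeq {S : Type*} (q : S → S → ℝ) (D : Set S) (μ : Killed D → ℝ) (α : ℝ) (n : ℕ) :
    Killed D → ℝ
  | some j => (-1) ^ n / α ^ n * ∑' i : Killed D, μ i * matPow (killedQ q D) n i (some j)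
  | none => 0

/-- `0 ≤ (-1)^n ∑_{i ∈ E_Δ} μ_i q^{n,T}_{ij} ≤ α^n` for all `j ∈ E`. -/
def PowerBounds {S : Type*} (q : S → S → ℝ) (D : Set S) (μ : Killed D → ℝ) (α : ℝ) (n : ℕ) : Prop :=
  ∀ j : {i : S // i ∉ D},
    0 ≤ (-1) ^ n * ∑' i : Killed D, μ i * matPow (killedQ q D) n i (some j) ∧
    (-1) ^ n * ∑' i : Killed D, μ i * matPow (killedQ q D) n i (some j) ≤ α ^ n

end

/-! Let `K` be the transition function of the chain killed on entering `D`, restricted to `E`, and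
`ν n` the restriction of `muSeq` to `E`. Absolute convergence turns the definition of `muSeq` into
the recurrence `ν n q = -α ν (n + 1)`.

The bridge from `q` to `K` is that `K` is the limit of exponentials of finite truncations of `q`
(`isMinimalKernel_subKernel`). For a finite matrix one differentiates `v exp(tM)`; passing to the
limit, `ν q ≤ -w` with `ν, w ≥ 0` gives `ν K_t + t exp(q_jj t) w_j ≤ ν` at `j`. Three facts follow.

* If the lifetime under `ν n` is exponential with parameter `α` and both `ν n` and `ν (n + 1)` are
distributions, then the lifetime under `ν (n + 1)` is exponential with the same parameter. The
nonnegative defect in the inequality, divided by `t`, has total mass tending to `α - α = 0`, so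
pairing it with the survival function also gives zero in the limit
(`exponential_of_isSubinvariant`). * A distribution with `ν q ≤ -α ν` and exponential lifetime of
parameter `α` satisfies `ν K_t = exp(-αt) ν`: iterating the inequality gives `exp(αt) ν K_t ≤ ν`,
and the two sides have equal mass (`vecMul_eq_of_isSubinvariant`). * If `ν K_t = exp(-βt) ν` for
small `t`, then `ν q = -β ν` (`mul_eq_mul_of_decay`).

For the first claim, a quasi-stationary `ν n` decays at some rate `β`, hence `α ν (n + 1) = β ν n`,
and it remains to see `β = α`. If the earlier terms are distributions, the first fact gives this. If
the entries are bounded, `ν (n + k) = (β/α)^k ν n` forces `β ≤ α`, while `ν 0 ≥ c ν n` with `c > 0`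
compares lifetimes and forces `α ≤ β`. The recurrence then propagates equality.

For the second claim, Fatou's lemma applied to the survival function and to its complement keeps the
exponential lifetime in the limit, the finite-sum inequality `ν q ≤ -α ν` also passes to the limit,
and the second fact applies. -/

noncomputable section

open scoped Matrix

/-! ### Finite matrices: differential inequalities and Euler's approximation -/

section FiniteMatrix

open scoped Matrix.Norms.Operator

variable {ι : Type*} [Fintype ι] [DecidableEq ι]

theorem le_of_hasDerivAt_nonpos {g g' : ℝ → ℝ} (hg : ∀ s, HasDerivAt g (g' s) s) {t : ℝ}
    (ht : 0 ≤ t) (h : ∀ s, 0 ≤ s → s ≤ t → g' s ≤ 0) : g t ≤ g 0 := by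
  have hanti : AntitoneOn g (Icc 0 t) := by
    refine antitoneOn_of_deriv_nonpos (convex_Icc 0 t)
      (fun s _ => (hg s).continuousAt.continuousWithinAt)
      (fun s _ => (hg s).differentiableAt.differentiableWithinAt) fun s hs => ?_
    rw [interior_Icc] at hs
    rw [(hg s).deriv]
    exact h s hs.1.le hs.2.le
  exact hanti ⟨le_rfl, ht⟩ ⟨ht, le_rfl⟩ ht

theorem hasDerivAt_matrix_exp_apply (M : Matrix ι ι ℝ) (s : ℝ) (i j : ι) :
    HasDerivAt (fun u : ℝ => NormedSpace.exp (u • M) i j) ((NormedSpace.exp (s • M) * M) i j) s :=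
  hasDerivAt_pi.1 (hasDerivAt_pi.1 (hasDerivAt_exp_smul_const (𝕂 := ℝ) M s) i) j

theorem hasDerivAt_matrix_exp_apply' (M : Matrix ι ι ℝ) (s : ℝ) (i j : ι) :
    HasDerivAt (fun u : ℝ => NormedSpace.exp (u • M) i j) ((M * NormedSpace.exp (s • M)) i j) s :=
  hasDerivAt_pi.1 (hasDerivAt_pi.1 (hasDerivAt_exp_smul_const' (𝕂 := ℝ) M s) i) j

theorem hasDerivAt_vecMul_exp (M : Matrix ι ι ℝ) (v : ι → ℝ) (s : ℝ) (j : ι) :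
    HasDerivAt (fun u : ℝ => (v ᵥ* NormedSpace.exp (u • M)) j)
      (((v ᵥ* M) ᵥ* NormedSpace.exp (s • M)) j) s := by
  rw [Matrix.vecMul_vecMul]
  simp only [Matrix.vecMul, dotProduct]
  exact HasDerivAt.fun_sum fun i _ => (hasDerivAt_matrix_exp_apply' M s i j).const_mul (v i)

theorem matrix_exp_add_smul (M : Matrix ι ι ℝ) (s t : ℝ) :
    NormedSpace.exp ((s + t) • M) = NormedSpace.exp (s • M) * NormedSpace.exp (t • M) := by
  rw [add_smul, Matrix.exp_add_of_commute]
  exact ((Commute.refl M).smul_left s).smul_right t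

/-- Off-diagonal terms only add mass: `exp(-M_jj s) exp(sM)_jj` is nondecreasing in `s ≥ 0`. -/
theorem exp_diag_le_matrix_exp {M : Matrix ι ι ℝ}
    (hoff : ∀ i j, i ≠ j → 0 ≤ M i j)
    (hexp : ∀ s : ℝ, 0 ≤ s → ∀ i j, 0 ≤ NormedSpace.exp (s • M) i j) {t : ℝ} (ht : 0 ≤ t) (j : ι) :
    Real.exp (M j j * t) ≤ NormedSpace.exp (t • M) j j := by
  have hd : ∀ s, HasDerivAt
      (fun u : ℝ => -(Real.exp (-(M j j) * u) * NormedSpace.exp (u • M) j j))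
      (-(Real.exp (-(M j j) * s) * -(M j j) * NormedSpace.exp (s • M) j j +
        Real.exp (-(M j j) * s) * (NormedSpace.exp (s • M) * M) j j)) s := by
    intro s
    have h1 : HasDerivAt (fun u : ℝ => Real.exp (-(M j j) * u))
        (Real.exp (-(M j j) * s) * -(M j j)) s := by
      simpa using ((hasDerivAt_id s).const_mul (-(M j j))).exp
    exact (h1.mul (hasDerivAt_matrix_exp_apply M s j j)).neg
  have h := le_of_hasDerivAt_nonpos hd ht fun s hs _ => by
    have : NormedSpace.exp (s • M) j j * M j j ≤ (NormedSpace.exp (s • M) * M) j j := by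
      rw [Matrix.mul_apply, ← Finset.add_sum_erase _ _ (Finset.mem_univ j)]
      refine le_add_of_nonneg_right (Finset.sum_nonneg fun k hk => ?_)
      exact mul_nonneg (hexp s hs _ _) (hoff _ _ (Finset.ne_of_mem_erase hk))
    nlinarith [Real.exp_pos (-(M j j) * s)]
  simp only [mul_zero, Real.exp_zero, zero_smul, NormedSpace.exp_zero, Matrix.one_apply_eq,
    mul_one, neg_le_neg_iff] at h
  have h2 := mul_le_mul_of_nonneg_left h (Real.exp_pos (M j j * t)).le
  rwa [← mul_assoc, ← Real.exp_add, mul_one, neg_mul, add_neg_cancel, Real.exp_zero, one_mul] at h2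

/-- The derivative of `v exp(sM)` is `(vM) exp(sM) ≤ -w exp(sM)`; keeping only the diagonal term at
`j` bounds it by `-exp(M_jj s) w_j`, which is at most `-exp(M_jj t) w_j` since `M_jj ≤ 0` and `s ≤
t`. -/
theorem vecMul_exp_add_le {M : Matrix ι ι ℝ}
    (hoff : ∀ i j, i ≠ j → 0 ≤ M i j) (hdiag : ∀ i, M i i ≤ 0)
    (hexp : ∀ s : ℝ, 0 ≤ s → ∀ i j, 0 ≤ NormedSpace.exp (s • M) i j)
    {v w : ι → ℝ} (hw : ∀ i, 0 ≤ w i) (hvw : ∀ i, (v ᵥ* M) i ≤ -w i)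
    {t : ℝ} (ht : 0 ≤ t) (j : ι) :
    (v ᵥ* NormedSpace.exp (t • M)) j + t * (Real.exp (M j j * t) * w j) ≤ v j := by
  have hd : ∀ s, HasDerivAt (fun u : ℝ => (v ᵥ* NormedSpace.exp (u • M)) j +
      u * (Real.exp (M j j * t) * w j))
      (((v ᵥ* M) ᵥ* NormedSpace.exp (s • M)) j + Real.exp (M j j * t) * w j) s := fun s => by
    have h := (hasDerivAt_vecMul_exp M v s j).add
      ((hasDerivAt_id s).mul_const (Real.exp (M j j * t) * w j))
    rw [one_mul] at h
    exact h
  have h := le_of_hasDerivAt_nonpos hd ht fun s hs hst => by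
    have h1 : ((v ᵥ* M) ᵥ* NormedSpace.exp (s • M)) j ≤
        ∑ k, -(w k * NormedSpace.exp (s • M) k j) :=
      Finset.sum_le_sum fun k _ => by
        rw [← neg_mul]
        exact mul_le_mul_of_nonneg_right (hvw k) (hexp s hs _ _)
    have h2 : w j * NormedSpace.exp (s • M) j j ≤ ∑ k, w k * NormedSpace.exp (s • M) k j :=
      Finset.single_le_sum (f := fun k => w k * NormedSpace.exp (s • M) k j)
        (fun k _ => mul_nonneg (hw k) (hexp s hs _ _)) (Finset.mem_univ j)
    have h3 : Real.exp (M j j * t) ≤ NormedSpace.exp (s • M) j j :=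
      (Real.exp_le_exp.2 (mul_le_mul_of_nonpos_left hst (hdiag j))).trans
        (exp_diag_le_matrix_exp hoff hexp hs j)
    rw [Finset.sum_neg_distrib] at h1
    nlinarith [mul_le_mul_of_nonneg_left h3 (hw j)]
  simpa using h

/-- In the derivative of `(v + u w) exp(uM)` the term `w exp(uM)` is cancelled by `vM ≤ -w`, and
what remains is nonpositive because `wM ≤ 0`. -/
theorem vecMul_exp_add_le_of_subinvariant {M : Matrix ι ι ℝ}
    (hexp : ∀ s : ℝ, 0 ≤ s → ∀ i j, 0 ≤ NormedSpace.exp (s • M) i j)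
    {v w : ι → ℝ} (hvw : ∀ i, (v ᵥ* M) i ≤ -w i) (hwM : ∀ i, (w ᵥ* M) i ≤ 0)
    {t : ℝ} (ht : 0 ≤ t) (j : ι) :
    (v ᵥ* NormedSpace.exp (t • M)) j + t * (w ᵥ* NormedSpace.exp (t • M)) j ≤ v j := by
  have hmono : ∀ {x y : ι → ℝ}, (∀ i, x i ≤ y i) → ∀ s : ℝ, 0 ≤ s →
      (x ᵥ* NormedSpace.exp (s • M)) j ≤ (y ᵥ* NormedSpace.exp (s • M)) j := fun hxy s hs =>
    Finset.sum_le_sum fun k _ => mul_le_mul_of_nonneg_right (hxy k) (hexp s hs _ _)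
  have hd : ∀ s, HasDerivAt (fun u : ℝ => (v ᵥ* NormedSpace.exp (u • M)) j +
      u * (w ᵥ* NormedSpace.exp (u • M)) j)
      (((v ᵥ* M) ᵥ* NormedSpace.exp (s • M)) j + (1 * (w ᵥ* NormedSpace.exp (s • M)) j +
        s * ((w ᵥ* M) ᵥ* NormedSpace.exp (s • M)) j)) s := fun s =>
    (hasDerivAt_vecMul_exp M v s j).add ((hasDerivAt_id s).mul (hasDerivAt_vecMul_exp M w s j))
  have h := le_of_hasDerivAt_nonpos hd ht fun s hs hst => by
    have h1 := hmono hvw s hs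
    have h2 := hmono (y := 0) hwM s hs
    have h3 : ((fun i => -w i) ᵥ* NormedSpace.exp (s • M)) j
        = -(w ᵥ* NormedSpace.exp (s • M)) j := by
      change ((-w) ᵥ* NormedSpace.exp (s • M)) j = _
      rw [Matrix.neg_vecMul]; rfl
    rw [Matrix.zero_vecMul, Pi.zero_apply] at h2
    rw [h3] at h1
    nlinarith [mul_nonpos_of_nonneg_of_nonpos hs h2]
  simpa using h

theorem norm_pow_sub_pow_le {R : Type*} [NormedRing R] {a b : R} {c : ℝ} (ha : ‖a‖ ≤ 1) (n : ℕ)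
    (hb : ∀ k < n, ‖b ^ k‖ ≤ c) : ‖a ^ n - b ^ n‖ ≤ n * (c * ‖a - b‖) := by
  induction n with
  | zero => simp
  | succ n ih =>
    have h1 : a ^ (n + 1) - b ^ (n + 1) = a * (a ^ n - b ^ n) + (a - b) * b ^ n := by
      rw [pow_succ', pow_succ']; noncomm_ring
    have h2 := ih fun k hk => hb k (hk.trans n.lt_succ_self)
    have h3 : ‖a * (a ^ n - b ^ n)‖ ≤ ‖a ^ n - b ^ n‖ :=
      (norm_mul_le _ _).trans (mul_le_of_le_one_left (norm_nonneg _) ha)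
    have h4 : ‖(a - b) * b ^ n‖ ≤ c * ‖a - b‖ := by
      rw [mul_comm c]
      exact (norm_mul_le _ _).trans (mul_le_mul_of_nonneg_left (hb n n.lt_succ_self) (norm_nonneg _))
    rw [h1]
    push_cast
    linarith [norm_add_le (a * (a ^ n - b ^ n)) ((a - b) * b ^ n)]

theorem norm_le_one_of_substochastic {A : Matrix ι ι ℝ} (h0 : ∀ i j, 0 ≤ A i j)
    (h1 : ∀ i, ∑ j, A i j ≤ 1) : ‖A‖ ≤ 1 := by
  rw [Matrix.linfty_opNorm_def]
  norm_cast
  refine Finset.sup_le fun i _ => ?_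
  rw [← NNReal.coe_le_coe]
  push_cast
  simpa [abs_of_nonneg (h0 i _)] using h1 i

/-- Euler's approximation of the matrix exponential by substochastic matrices. -/
theorem tendsto_pow_matrix_exp {A : ℝ → Matrix ι ι ℝ} {M : Matrix ι ι ℝ} (hA0 : A 0 = 1)
    (hA : ∀ i j, HasDerivWithinAt (fun h => A h i j) (M i j) (Ici 0) 0)
    (hpos : ∀ h, 0 ≤ h → ∀ i j, 0 ≤ A h i j) (hsum : ∀ h, 0 ≤ h → ∀ i, ∑ j, A h i j ≤ 1)
    {t : ℝ} (ht : 0 ≤ t) :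
    Tendsto (fun n : ℕ => A (t / 2 ^ n) ^ (2 ^ n)) atTop (𝓝 (NormedSpace.exp (t • M))) := by
  have hder : HasDerivWithinAt (fun h : ℝ => A h - NormedSpace.exp (h • M)) 0 (Ici 0) 0 := by
    have h1 : HasDerivWithinAt A M (Ici 0) 0 :=
      hasDerivWithinAt_pi.2 fun i => hasDerivWithinAt_pi.2 fun j => hA i j
    have h2 := (hasDerivAt_exp_smul_const (𝕂 := ℝ) M 0).hasDerivWithinAt (s := Ici 0)
    have h3 := h1.sub h2
    rw [zero_smul, NormedSpace.exp_zero, one_mul, sub_self] at h3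
    exact h3
  -- One step has error `o(h)`, so `2 ^ n` steps of length `t / 2 ^ n` have total error `o(1)`.
  have hlit := hder.isLittleO
  simp only [hA0, zero_smul, NormedSpace.exp_zero, sub_self, sub_zero, smul_zero] at hlit
  obtain ⟨c, hc⟩ := (isCompact_Icc (a := (0 : ℝ)) (b := t)).exists_bound_of_continuousOn
    (f := fun s : ℝ => NormedSpace.exp (s • M))
    (fun s _ => (hasDerivAt_exp_smul_const (𝕂 := ℝ) M s).continuousAt.continuousWithinAt)
  have hu : Tendsto (fun n : ℕ => t / 2 ^ n) atTop (𝓝[Ici 0] 0) := by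
    refine tendsto_nhdsWithin_iff.2 ⟨?_, Eventually.of_forall fun n => by
      simp only [mem_Ici]; positivity⟩
    exact tendsto_const_nhds.div_atTop (tendsto_pow_atTop_atTop_of_one_lt one_lt_two)
  have hlit2 := (hlit.comp_tendsto hu).norm_left
  have hlim : Tendsto (fun n : ℕ => (2 ^ n : ℝ) *
      ‖A (t / 2 ^ n) - NormedSpace.exp ((t / 2 ^ n) • M)‖) atTop (𝓝 0) := by
    have h4 : (fun n : ℕ => (2 ^ n : ℝ) * ‖A (t / 2 ^ n) - NormedSpace.exp ((t / 2 ^ n) • M)‖)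
        =o[atTop] fun n : ℕ => (2 ^ n : ℝ) * (t / 2 ^ n) :=
      (Asymptotics.isBigO_refl (fun n : ℕ => (2 ^ n : ℝ)) atTop).mul_isLittleO hlit2
    have h5 : (fun n : ℕ => (2 ^ n : ℝ) * (t / 2 ^ n)) = fun _ => t := by
      funext n; field_simp
    rw [h5] at h4
    exact (Asymptotics.isLittleO_one_iff ℝ).1
      (h4.trans_isBigO (Asymptotics.isBigO_const_const t one_ne_zero _))
  refine tendsto_iff_norm_sub_tendsto_zero.2 ?_
  refine squeeze_zero (fun _ => norm_nonneg _) (fun n => ?_) (by simpa using hlim.const_mul c)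
  have hn : (0 : ℝ) < 2 ^ n := by positivity
  have hpow : ∀ k : ℕ, NormedSpace.exp ((t / 2 ^ n) • M) ^ k =
      NormedSpace.exp ((k * (t / 2 ^ n)) • M) := fun k => by
    rw [← Matrix.exp_nsmul, mul_smul, Nat.cast_smul_eq_nsmul]
  have h2n : NormedSpace.exp (t • M) = NormedSpace.exp ((t / 2 ^ n) • M) ^ (2 ^ n) := by
    rw [hpow]; congr 2; push_cast; field_simp
  rw [h2n]
  refine (norm_pow_sub_pow_le (c := c) (norm_le_one_of_substochastic (hpos _ (by positivity))
    (hsum _ (by positivity))) _ fun k hk => ?_).trans (le_of_eq (by push_cast; ring))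
  rw [hpow]
  refine hc _ ⟨by positivity, ?_⟩
  have hk' : (k : ℝ) ≤ 2 ^ n := by exact_mod_cast hk.le
  calc (k : ℝ) * (t / 2 ^ n) ≤ 2 ^ n * (t / 2 ^ n) := by gcongr
    _ = t := by field_simp

end FiniteMatrix

/-! ### Step paths -/

section StepPath

variable {S : Type*} {x : ℝ≥0 → S}

/-- Right-continuity lets a time `s < t` be replaced by the next grid point to its right. This
reduces events about all times to countably many times. -/
theorem IsStepPath.forall_dyadic_mem_iff (hx : IsStepPath x) (F : Set S) (t : ℝ≥0) :
    (∀ n k : ℕ, k ≤ 2 ^ n → x (k * (t / 2 ^ n)) ∈ F) ↔ ∀ s ≤ t, x s ∈ F := by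
  constructor
  · intro h s hst
    rcases hst.eq_or_lt with rfl | hst
    · simpa using h 0 1 le_rfl
    obtain ⟨ε, hε, hs⟩ := hx.1 s
    have ht : 0 < t := bot_le.trans_lt hst
    have hlim : Tendsto (fun n : ℕ => t / (2 : ℝ≥0) ^ n) atTop (𝓝 0) := by
      rw [← NNReal.tendsto_coe]
      push_cast
      exact tendsto_const_nhds.div_atTop (tendsto_pow_atTop_atTop_of_one_lt one_lt_two)
    obtain ⟨n, hn⟩ := (hlim.eventually (gt_mem_nhds hε)).exists
    have hδ : 0 < t / 2 ^ n := by positivity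
    have h1 : s ≤ ⌈s / (t / 2 ^ n)⌉₊ * (t / 2 ^ n) := (div_le_iff₀ hδ).1 (Nat.le_ceil _)
    have h2 : ⌈s / (t / 2 ^ n)⌉₊ * (t / 2 ^ n) < s + ε := by
      have h3 := Nat.ceil_lt_add_one (zero_le (a := s / (t / 2 ^ n)))
      have h4 := mul_lt_mul_of_pos_right h3 hδ
      rw [add_mul, one_mul, div_mul_cancel₀ _ hδ.ne'] at h4
      exact h4.trans_le (by gcongr)
    rw [← hs _ h1 h2]
    refine h n _ (Nat.ceil_le.2 ?_)
    rw [div_le_iff₀ hδ]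
    push_cast
    rw [mul_div_cancel₀ _ (by positivity)]
    exact hst.le
  · intro h n k hk
    refine h _ ?_
    have hk' : (k : ℝ≥0) ≤ 2 ^ n := by exact_mod_cast hk
    calc (k : ℝ≥0) * (t / 2 ^ n) ≤ 2 ^ n * (t / 2 ^ n) := by gcongr
      _ = t := mul_div_cancel₀ _ (by positivity)

/-- Each time has a neighbourhood on which the path takes at most two values; compactness does the
rest. -/
theorem IsStepPath.finite_image_Icc (hx : IsStepPath x) (t : ℝ≥0) : (x '' Icc 0 t).Finite := by
  refine (isCompact_Icc (a := (0 : ℝ≥0)) (b := t)).induction_on (p := fun s => (x '' s).Finite)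
    (by simp) (fun s s' hss h => h.subset (image_mono hss))
    (fun s s' h h' => by rw [image_union]; exact h.union h') fun s _ => ?_
  obtain ⟨ε, hε, hr⟩ := hx.1 s
  have hs : s < s + ε := lt_add_of_pos_right s hε
  rcases eq_or_lt_of_le (zero_le (a := s)) with h0 | h0
  · refine ⟨Iio (s + ε), mem_nhdsWithin_of_mem_nhds (Iio_mem_nhds hs),
      (finite_singleton (x s)).subset ?_⟩
    rintro _ ⟨u, hu, rfl⟩
    exact hr u (h0 ▸ zero_le) hu
  · obtain ⟨l, r, hrs, hl⟩ := hx.2 s h0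
    refine ⟨Ioo r (s + ε), mem_nhdsWithin_of_mem_nhds (Ioo_mem_nhds hrs hs),
      (toFinite {l, x s}).subset ?_⟩
    rintro _ ⟨u, hu, rfl⟩
    rcases lt_or_ge u s with h | h
    · exact Or.inl (hl u hu.1 h)
    · exact Or.inr (hr u h hu.2)

end StepPath

/-! ### The chain, its hitting time and its `q`-matrix -/

namespace CTMarkovChain

variable {S Ω : Type*} [MeasurableSpace Ω] (C : CTMarkovChain S Ω)

instance (i : S) : IsProbabilityMeasure (C.P i) := C.isProb i

/-- Right-continuity at `t` keeps the path outside `D` a little longer, which makes the inequality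
strict. -/
theorem lt_hit_iff_of_isStepPath {D : Set S} {ω : Ω} (hω : IsStepPath fun t => C.X t ω) (t : ℝ≥0) :
    (t : ℝ≥0∞) < C.hit D ω ↔ ∀ s ≤ t, C.X s ω ∉ D := by
  constructor
  · intro h s hs
    exact C.not_mem_of_lt_hit ((ENNReal.coe_le_coe.2 hs).trans_lt h)
  · intro h
    obtain ⟨ε, hε, hr⟩ := hω.1 t
    have h1 : ((t + ε : ℝ≥0) : ℝ≥0∞) ≤ C.hit D ω := by
      refine le_iInf₂ fun s hs => ENNReal.coe_le_coe.2 ?_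
      by_contra! hlt
      rcases le_total s t with h' | h'
      · exact h s h' hs
      · exact h t le_rfl ((hr s h' hlt).subst (motive := (· ∈ D)) hs)
    exact (ENNReal.coe_lt_coe.2 (lt_add_of_pos_right t hε)).trans_le h1

theorem killed_eq_some_iff {D : Set S} {t : ℝ≥0} {ω : Ω} {j : {i : S // i ∉ D}} :
    C.killed D t ω = some j ↔ (t : ℝ≥0∞) < C.hit D ω ∧ C.X t ω = j := by
  unfold killed
  split_ifs with h
  · simp [h, Subtype.ext_iff]
  · simp [h]

theorem killed_eq_none_iff {D : Set S} {t : ℝ≥0} {ω : Ω} :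
    C.killed D t ω = none ↔ ¬ (t : ℝ≥0∞) < C.hit D ω := by
  unfold killed
  split_ifs with h <;> simp [h]

theorem transProb_nonneg (t : ℝ) (i j : S) : 0 ≤ C.transProb t i j := measureReal_nonneg

theorem transProb_le_one (t : ℝ) (i j : S) : C.transProb t i j ≤ 1 := measureReal_le_one

theorem transProb_zero [DecidableEq S] (i j : S) : C.transProb 0 i j = if i = j then 1 else 0 := by
  unfold transProb
  rw [Real.toNNReal_zero]
  split_ifs with h
  · subst h
    rw [measureReal_congr (t := univ), probReal_univ]
    filter_upwards [C.start i] with ω hω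
    exact propext ⟨fun _ => trivial, fun _ => hω⟩
  · rw [measureReal_congr (t := ∅), measureReal_empty]
    filter_upwards [C.start i] with ω hω
    exact propext ⟨fun h' => h (hω.symm.trans h'), False.elim⟩

theorem IsQMatrix.nonneg {C : CTMarkovChain S Ω} {q : S → S → ℝ} (hq : C.IsQMatrix q) {i j : S}
    (hij : i ≠ j) : 0 ≤ q i j := by
  classical
  have h := hasDerivWithinAt_iff_tendsto_slope.1 (hq i j)
  rw [Ici_sdiff_left] at h
  refine ge_of_tendsto h (eventually_mem_nhdsWithin.mono fun t ht => ?_)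
  rw [slope_def_field, C.transProb_zero, if_neg hij, sub_zero, sub_zero]
  exact div_nonneg (C.transProb_nonneg _ _ _) (le_of_lt ht)

theorem IsQMatrix.diag_nonpos {C : CTMarkovChain S Ω} {q : S → S → ℝ} (hq : C.IsQMatrix q)
    (i : S) : q i i ≤ 0 := by
  classical
  have h := hasDerivWithinAt_iff_tendsto_slope.1 (hq i i)
  rw [Ici_sdiff_left] at h
  refine le_of_tendsto h (eventually_mem_nhdsWithin.mono fun t ht => ?_)
  rw [slope_def_field, C.transProb_zero, if_pos rfl, sub_zero]
  exact div_nonpos_of_nonpos_of_nonneg (sub_nonpos.2 (C.transProb_le_one _ _ _)) (le_of_lt ht)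

/-! ### The chain killed on leaving a finite set -/

section Grid

variable {ι : Type*} [Fintype ι] (f : ι → S)

/-- The transition matrix of the chain restricted to the range of `f`. -/
def transMatrix (h : ℝ) : Matrix ι ι ℝ := Matrix.of fun a b => C.transProb h (f a) (f b)

variable {f}

theorem sum_transMatrix_le_one (hf : Function.Injective f) (h : ℝ) (a : ι) :
    ∑ b, C.transMatrix f h a b ≤ 1 := by
  simp only [transMatrix, Matrix.of_apply, transProb]
  rw [← measureReal_biUnion_finset]
  · exact measureReal_le_one
  · exact fun b _ b' _ hbb => Set.disjoint_left.2 fun ω h1 h2 => hbb (hf (h1.symm.trans h2))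
  · exact fun b _ => C.measurable_state _ _

variable [DecidableEq ι]

variable (f) in
/-- The chain is in the range of `f` at the times `0, h, …, N h`, and equals `f b` at the last
of them. -/
def gridEvent (h : ℝ≥0) (N : ℕ) (b : ι) : Set Ω :=
  {ω | (∀ k ≤ N, C.X (k * h) ω ∈ range f) ∧ C.X (N * h) ω = f b}

theorem gridEvent_eq_biUnion (hf : Function.Injective f) (h : ℝ≥0) (N : ℕ) (b : ι) :
    C.gridEvent f h N b = ⋃ x ∈ Finset.univ.filter fun x : Fin (N + 1) → ι => x (Fin.last N) = b,
      {ω | ∀ m : Fin (N + 1), C.X ((m : ℕ) * h) ω = f (x m)} := by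
  ext ω
  simp only [gridEvent, mem_ofPred_eq, Finset.mem_filter, Finset.mem_univ, true_and, mem_iUnion,
    exists_prop]
  constructor
  · rintro ⟨h1, h2⟩
    choose y hy using fun m : Fin (N + 1) => h1 m (Nat.lt_succ_iff.1 m.2)
    refine ⟨y, hf ?_, fun m => (hy m).symm⟩
    rw [hy, ← h2, Fin.val_last]
  · rintro ⟨y, hy, h1⟩
    refine ⟨fun k hk => ⟨y ⟨k, Nat.lt_succ_iff.2 hk⟩, (h1 ⟨k, Nat.lt_succ_iff.2 hk⟩).symm⟩, ?_⟩
    rw [← hy, ← h1 (Fin.last N), Fin.val_last]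

theorem measurableSet_cylinder (h : ℝ≥0) (N : ℕ) (x : Fin (N + 1) → S) :
    MeasurableSet {ω | ∀ m : Fin (N + 1), C.X ((m : ℕ) * h) ω = x m} := by
  rw [ofPred_forall]
  exact MeasurableSet.iInter fun m => C.measurable_state _ _

theorem measurableSet_gridEvent (hf : Function.Injective f) (h : ℝ≥0) (N : ℕ) (b : ι) :
    MeasurableSet (C.gridEvent f h N b) := by
  rw [C.gridEvent_eq_biUnion hf]
  exact Finset.measurableSet_biUnion _ fun x _ => C.measurableSet_cylinder h N (fun m => f (x m))

/-- The Markov property is postulated for cylinders; the grid event is a finite disjoint union of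
these, all ending at `f b`. -/
theorem measureReal_gridEvent_inter (hf : Function.Injective f) (i : S) (h : ℝ≥0) (N : ℕ) (b : ι)
    (s : ℝ≥0) (k : S) :
    (C.P i).real (C.gridEvent f h N b ∩ {ω | C.X (N * h + s) ω = k}) =
      (C.P i).real (C.gridEvent f h N b) * (C.P (f b)).real {ω | C.X s ω = k} := by
  have hdisj : ∀ x y : Fin (N + 1) → ι, x ≠ y →
      Disjoint {ω | ∀ m : Fin (N + 1), C.X ((m : ℕ) * h) ω = f (x m)}
        {ω | ∀ m : Fin (N + 1), C.X ((m : ℕ) * h) ω = f (y m)} := fun x y hxy =>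
    Set.disjoint_left.2 fun ω hx hy => hxy (funext fun m => hf ((hx m).symm.trans (hy m)))
  rw [C.gridEvent_eq_biUnion hf, iUnion₂_inter, measureReal_biUnion_finset,
    measureReal_biUnion_finset, Finset.sum_mul]
  · refine Finset.sum_congr rfl fun x hx => ?_
    have hx' : x (Fin.last N) = b := by simpa using hx
    have hmono : Monotone fun m : Fin (N + 1) => ((m : ℕ) : ℝ≥0) * h := fun m m' hm => by
      have : ((m : ℕ) : ℝ≥0) ≤ ((m' : ℕ) : ℝ≥0) := by exact_mod_cast hm
      exact mul_le_mul_left this h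
    have hm := C.markov i N (fun m => (m : ℕ) * h) (fun m => f (x m)) s k hmono
    simp only [Fin.val_last, hx'] at hm
    rw [measureReal_def, measureReal_def, measureReal_def, ← ENNReal.toReal_mul, ← hm]
    rfl
  · exact fun x _ y _ hxy => hdisj x y hxy
  · exact fun x _ => C.measurableSet_cylinder h N fun m => f (x m)
  · exact fun x _ y _ hxy => (hdisj x y hxy).mono inter_subset_left inter_subset_left
  · exact fun x _ => (C.measurableSet_cylinder h N fun m => f (x m)).inter (C.measurable_state _ _)

theorem measureReal_gridEvent (hf : Function.Injective f) (h : ℝ≥0) (N : ℕ) (a b : ι) :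
    (C.P (f a)).real (C.gridEvent f h N b) = (C.transMatrix f h ^ N) a b := by
  classical
  induction N generalizing b with
  | zero =>
    have h0 : C.gridEvent f h 0 b = {ω | C.X 0 ω = f b} := by
      ext ω
      simp only [gridEvent, Nat.le_zero, forall_eq, Nat.cast_zero, zero_mul, mem_ofPred_eq,
        and_iff_right_iff_imp]
      exact fun h => ⟨b, h.symm⟩
    have h1 := C.transProb_zero (f a) (f b)
    rw [transProb, Real.toNNReal_zero] at h1
    rw [h0, h1, pow_zero, Matrix.one_apply]
    simp [hf.eq_iff]
  | succ N ih =>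
    have h1 : C.gridEvent f h (N + 1) b =
        ⋃ c ∈ (Finset.univ : Finset ι), C.gridEvent f h N c ∩ {ω | C.X (N * h + h) ω = f b} := by
      have h2 : ((N + 1 : ℕ) : ℝ≥0) * h = N * h + h := by push_cast; ring
      ext ω
      simp only [gridEvent, mem_ofPred_eq, mem_iUnion, mem_inter_iff, Finset.mem_univ, exists_prop,
        true_and, h2]
      constructor
      · rintro ⟨h3, h4⟩
        obtain ⟨c, hc⟩ := h3 N N.le_succ
        exact ⟨c, ⟨fun k hk => h3 k (hk.trans N.le_succ), hc.symm⟩, h4⟩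
      · rintro ⟨c, ⟨h3, h4⟩, h5⟩
        refine ⟨fun k hk => ?_, h5⟩
        rcases Nat.le_succ_iff.1 hk with hk | rfl
        · exact h3 k hk
        · exact ⟨b, by rw [Nat.succ_eq_add_one, h2, h5]⟩
    rw [h1, measureReal_biUnion_finset, pow_succ, Matrix.mul_apply]
    · refine Finset.sum_congr rfl fun c _ => ?_
      rw [C.measureReal_gridEvent_inter hf, ih, transMatrix, Matrix.of_apply, transProb,
        Real.toNNReal_coe]
    · refine fun c _ c' _ hcc => Set.disjoint_left.2 fun ω h3 h4 => hcc (hf ?_)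
      exact h3.1.2.symm.trans h4.1.2
    · exact fun c _ => (C.measurableSet_gridEvent hf h N c).inter (C.measurable_state _ _)

/-- The transition probabilities of the chain killed on leaving a finite set are given by the
exponential of the truncated `q`-matrix. -/
theorem measureReal_taboo_eq_exp {q : S → S → ℝ} (hq : C.IsQMatrix q)
    (hf : Function.Injective f) (t : ℝ≥0) (a b : ι) :
    (C.P (f a)).real {ω | (∀ s ≤ t, C.X s ω ∈ range f) ∧ C.X t ω = f b} =
      NormedSpace.exp ((t : ℝ) • Matrix.of fun a b => q (f a) (f b)) a b := by
  classical
  have hlim := tendsto_pow_matrix_exp (A := C.transMatrix f)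
    (M := Matrix.of fun a b => q (f a) (f b)) (t := (t : ℝ))
    (by
      ext a b
      rw [transMatrix, Matrix.of_apply, C.transProb_zero, Matrix.one_apply]
      simp [hf.eq_iff])
    (fun a b => hq (f a) (f b)) (fun h _ a b => C.transProb_nonneg _ _ _)
    (fun h _ a => C.sum_transMatrix_le_one hf h a) t.2
  have hab : Tendsto (fun n : ℕ => (C.transMatrix f (t / 2 ^ n) ^ (2 ^ n)) a b) atTop
      (𝓝 (NormedSpace.exp ((t : ℝ) • Matrix.of fun a b => q (f a) (f b)) a b)) :=
    tendsto_pi_nhds.1 (tendsto_pi_nhds.1 hlim a) b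
  have hG : ∀ n : ℕ, (C.transMatrix f (t / 2 ^ n) ^ (2 ^ n)) a b =
      (C.P (f a)).real (C.gridEvent f (t / 2 ^ n) (2 ^ n) b) := fun n => by
    rw [C.measureReal_gridEvent hf]; push_cast; rfl
  simp only [hG] at hab
  refine tendsto_nhds_unique ?_ hab
  -- Refining the dyadic grid adds constraints. The intersection over `n` is almost surely the event
  -- for all times up to `t`.
  have hanti : Antitone fun n : ℕ => C.gridEvent f (t / 2 ^ n) (2 ^ n) b := by
    refine antitone_nat_of_succ_le fun n ω hω => ⟨fun k hk => ?_, ?_⟩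
    · have h1 := hω.1 (2 * k) (by rw [pow_succ']; omega)
      convert h1 using 2
      push_cast
      rw [pow_succ']
      field_simp
    · have h1 := hω.2
      convert h1 using 2
      push_cast
      field_simp
  have hlim2 := tendsto_measure_iInter_atTop (μ := C.P (f a))
    (fun n => (C.measurableSet_gridEvent hf (t / 2 ^ n) (2 ^ n) b).nullMeasurableSet) hanti
    ⟨0, measure_ne_top _ _⟩
  have hlim3 := (ENNReal.tendsto_toReal (measure_ne_top (C.P (f a)) _)).comp hlim2
  have hae : {ω | (∀ s ≤ t, C.X s ω ∈ range f) ∧ C.X t ω = f b} =ᵐ[C.P (f a)]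
      ⋂ n : ℕ, C.gridEvent f (t / 2 ^ n) (2 ^ n) b := ?_
  · rw [measureReal_congr hae]
    exact hlim3
  filter_upwards [C.step_paths (f a)] with ω hω
  refine propext ?_
  change ((∀ s ≤ t, C.X s ω ∈ range f) ∧ C.X t ω = f b) ↔
    ω ∈ ⋂ n : ℕ, C.gridEvent f (t / 2 ^ n) (2 ^ n) b
  rw [mem_iInter, ← hω.forall_dyadic_mem_iff]
  have ht : ∀ n : ℕ, ((2 ^ n : ℕ) : ℝ≥0) * (t / 2 ^ n) = t := fun n => by
    push_cast; field_simp
  simp only [gridEvent, mem_ofPred_eq, ht]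
  exact ⟨fun h n => ⟨h.1 n, h.2⟩, fun h => ⟨fun n => (h n).1, (h 0).2⟩⟩

end Grid

end CTMarkovChain

/-! ### Minimal transition functions, and the killed chain as an instance -/

open Classical in
/-- The exponential of the truncation of `q` to a finite set `F`, extended by zero. -/
def truncExp {E : Type*} (q : E → E → ℝ) (F : Finset E) (t : ℝ) (i j : E) : ℝ :=
  if h : i ∈ F ∧ j ∈ F then
    NormedSpace.exp (t • Matrix.of fun a b : F => q a b) ⟨i, h.1⟩ ⟨j, h.2⟩
  else 0

/-- `K` is the minimal transition function of the `q`-matrix `q`, described as the limit of the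
transition functions of its finite truncations. -/
structure IsMinimalKernel {E : Type*} (q : E → E → ℝ) (K : ℝ≥0 → E → E → ℝ) : Prop where
  offDiag_nonneg : ∀ i j, i ≠ j → 0 ≤ q i j
  diag_nonpos : ∀ i, q i i ≤ 0
  trunc_nonneg : ∀ (F : Finset E) (t : ℝ≥0) i j, 0 ≤ truncExp q F t i j
  trunc_le : ∀ (F : Finset E) (t : ℝ≥0) i j, truncExp q F t i j ≤ K t i j
  tendsto_trunc : ∀ (t : ℝ≥0) i j, Tendsto (fun F => truncExp q F t i j) atTop (𝓝 (K t i j))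
  sum_le_one : ∀ (t : ℝ≥0) i (F : Finset E), ∑ j ∈ F, K t i j ≤ 1

namespace CTMarkovChain

variable {S Ω : Type*} [MeasurableSpace Ω] (C : CTMarkovChain S Ω)

/-- `P_i(X^T_t = j)` for `i, j ∈ E`. -/
def subKernel (D : Set S) (t : ℝ≥0) (i j : {i : S // i ∉ D}) : ℝ :=
  (C.P i).real {ω | C.killed D t ω = some j}

/-- `P_i(T > t)`. -/
def survivalFrom (D : Set S) (t : ℝ≥0) (i : {i : S // i ∉ D}) : ℝ :=
  (C.P i).real {ω | (t : ℝ≥0∞) < C.hit D ω}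

/-- Paths are step paths only almost surely, so the event agrees with a countable dyadic
intersection only up to a null set. -/
theorem nullMeasurableSet_lt_hit (D : Set S) [Countable S] (t : ℝ≥0) (i : S) :
    NullMeasurableSet {ω | (t : ℝ≥0∞) < C.hit D ω} (C.P i) := by
  have hX : ∀ s, MeasurableSet {ω | C.X s ω ∉ D} := fun s => by
    have h : {ω | C.X s ω ∉ D} = ⋃ j ∈ Dᶜ, {ω | C.X s ω = j} := by
      ext ω; simp
    rw [h]
    exact MeasurableSet.biUnion (to_countable _) fun j _ => C.measurable_state s j
  have hm : MeasurableSet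
      (⋂ (n : ℕ) (k : ℕ) (_ : k ≤ 2 ^ n), {ω | C.X (k * (t / 2 ^ n)) ω ∉ D}) :=
    MeasurableSet.iInter fun n => MeasurableSet.iInter fun k => MeasurableSet.iInter fun _ => hX _
  refine hm.nullMeasurableSet.congr ?_
  filter_upwards [C.step_paths i] with ω hω
  refine propext ?_
  change ω ∈ (⋂ (n : ℕ) (k : ℕ) (_ : k ≤ 2 ^ n), {ω | C.X (k * (t / 2 ^ n)) ω ∉ D}) ↔
    (t : ℝ≥0∞) < C.hit D ω
  rw [C.lt_hit_iff_of_isStepPath hω]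
  have h := hω.forall_dyadic_mem_iff Dᶜ t
  simp only [mem_compl_iff] at h
  rw [← h]
  simp

theorem nullMeasurableSet_killed_eq (D : Set S) [Countable S] (t : ℝ≥0) (i : S)
    (j : {i : S // i ∉ D}) : NullMeasurableSet {ω | C.killed D t ω = some j} (C.P i) := by
  have h : {ω | C.killed D t ω = some j} =
      {ω | (t : ℝ≥0∞) < C.hit D ω} ∩ {ω | C.X t ω = j} := by
    ext ω
    exact C.killed_eq_some_iff
  rw [h]
  exact (C.nullMeasurableSet_lt_hit D t i).inter (C.measurable_state t j).nullMeasurableSet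

theorem survivalFrom_le_one (D : Set S) (t : ℝ≥0) (i : {i : S // i ∉ D}) :
    C.survivalFrom D t i ≤ 1 := measureReal_le_one

theorem hasSum_subKernel [Countable S] (D : Set S) (t : ℝ≥0) (i : {i : S // i ∉ D}) :
    HasSum (C.subKernel D t i) (C.survivalFrom D t i) := by
  have h1 : {ω | (t : ℝ≥0∞) < C.hit D ω} = ⋃ j, {ω | C.killed D t ω = some j} := by
    ext ω
    simp only [mem_ofPred_eq, mem_iUnion, ← Option.ne_none_iff_exists']
    rw [Ne, C.killed_eq_none_iff, not_not]
  have h2 : C.P i {ω | (t : ℝ≥0∞) < C.hit D ω} = ∑' j, C.P i {ω | C.killed D t ω = some j} := by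
    rw [h1]
    refine measure_iUnion₀ (fun j k hjk => Disjoint.aedisjoint ?_)
      (fun j => C.nullMeasurableSet_killed_eq D t i j)
    exact Set.disjoint_left.2 fun ω hj hk => hjk (Option.some_injective _ (hj.symm.trans hk))
  unfold survivalFrom subKernel
  rw [measureReal_def, h2]
  rw [ENNReal.tsum_toReal_eq fun _ => measure_ne_top _ _]
  exact ENNReal.hasSum_toReal (h2 ▸ measure_ne_top _ _)

/-- A step path visits finitely many states in `[0, t]`, so survival up to `t` is almost surely the
increasing union, over finite `F ⊆ E`, of the events of staying in `F`; `measureReal_taboo_eq_exp`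
computes each of these. -/
theorem isMinimalKernel_subKernel [Countable S] {q : S → S → ℝ} (hq : C.IsQMatrix q) (D : Set S) :
    IsMinimalKernel (fun i j : {i : S // i ∉ D} => q i j) (C.subKernel D) := by
  classical
  let U : Finset {i : S // i ∉ D} → ℝ≥0 → {i : S // i ∉ D} → Set Ω := fun F t j =>
    {ω | (∀ s ≤ t, C.X s ω ∈ range fun a : F => ((a : {i : S // i ∉ D}) : S)) ∧ C.X t ω = j}
  have htr : ∀ (F : Finset {i : S // i ∉ D}) (t : ℝ≥0) (i j), i ∈ F → j ∈ F →
      truncExp (fun i j : {i : S // i ∉ D} => q i j) F t i j = (C.P i).real (U F t j) := by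
    intro F t i j hi hj
    rw [truncExp, dif_pos ⟨hi, hj⟩]
    convert (C.measureReal_taboo_eq_exp hq
      (f := fun a : F => ((a : {i : S // i ∉ D}) : S))
      (Subtype.val_injective.comp Subtype.val_injective) t ⟨i, hi⟩ ⟨j, hj⟩).symm
  have hsub : ∀ (t : ℝ≥0) (i j : {i : S // i ∉ D}),
      {ω | C.killed D t ω = some j} =ᵐ[C.P i] ⋃ F, U F t j := by
    intro t i j
    filter_upwards [C.step_paths i] with ω hω
    refine propext ?_
    change C.killed D t ω = some j ↔ ω ∈ ⋃ F, U F t j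
    rw [C.killed_eq_some_iff, C.lt_hit_iff_of_isStepPath hω, mem_iUnion]
    constructor
    · rintro ⟨h1, h2⟩
      have hfin := (hω.finite_image_Icc t).preimage
        (f := ((↑) : {i : S // i ∉ D} → S)) Subtype.val_injective.injOn
      refine ⟨hfin.toFinset, fun s hs => ⟨⟨⟨C.X s ω, h1 s hs⟩, ?_⟩, rfl⟩, h2⟩
      rw [Set.Finite.mem_toFinset]
      exact ⟨s, ⟨zero_le, hs⟩, rfl⟩
    · rintro ⟨F, h1, h2⟩
      refine ⟨fun s hs => ?_, h2⟩
      obtain ⟨a, ha⟩ := h1 s hs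
      rw [← ha]
      exact a.1.2
  have hle : ∀ (F : Finset {i : S // i ∉ D}) (t : ℝ≥0) (i j : {i : S // i ∉ D}),
      (C.P i).real (U F t j) ≤ C.subKernel D t i j := fun F t i j => by
    rw [subKernel, measureReal_congr (hsub t i j)]
    exact measureReal_mono (subset_iUnion (fun F => U F t j) F)
  refine ⟨fun i j hij => hq.nonneg fun h => hij (Subtype.ext h), fun i => hq.diag_nonpos i,
    fun F t i j => ?_, fun F t i j => ?_, fun t i j => ?_, fun t i F => ?_⟩
  · by_cases h : i ∈ F ∧ j ∈ F
    · rw [htr F t i j h.1 h.2]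
      exact measureReal_nonneg
    · rw [truncExp, dif_neg h]
  · by_cases h : i ∈ F ∧ j ∈ F
    · rw [htr F t i j h.1 h.2]
      exact hle F t i j
    · rw [truncExp, dif_neg h]
      exact measureReal_nonneg
  · have hmono : Monotone fun F => U F t j := by
      intro F G hFG ω hω
      refine ⟨fun s hs => ?_, hω.2⟩
      obtain ⟨a, ha⟩ := hω.1 s hs
      exact ⟨⟨a, hFG a.2⟩, ha⟩
    have h1 := (ENNReal.tendsto_toReal (measure_ne_top (C.P i) _)).comp
      (tendsto_measure_iUnion_atTop (μ := C.P i) hmono)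
    rw [subKernel, measureReal_congr (hsub t i j)]
    refine h1.congr' ?_
    filter_upwards [eventually_ge_atTop {i, j}] with F hF
    exact (htr F t i j (hF (by simp)) (hF (by simp))).symm
  · exact (sum_le_hasSum F (fun _ _ => measureReal_nonneg) (C.hasSum_subKernel D t i)).trans
      (C.survivalFrom_le_one D t i)

end CTMarkovChain

/-! ### Subinvariance and its consequences for finite sums -/

/-- `ν q ≤ -w`, in the sense of finite partial sums. -/
def IsSubinvariant {E : Type*} (q : E → E → ℝ) (ν w : E → ℝ) : Prop :=
  ∀ (j : E) (G : Finset E), j ∈ G → ∑ i ∈ G, ν i * q i j ≤ -w j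

/-- Since `j ∈ G`, the terms omitted from the full series are off-diagonal, hence nonnegative. -/
theorem isSubinvariant_of_summable {E : Type*} {q : E → E → ℝ} {ν w : E → ℝ}
    (hq : ∀ i j, i ≠ j → 0 ≤ q i j) (hν : ∀ i, 0 ≤ ν i) (hs : ∀ j, Summable fun i => ν i * q i j)
    (h : ∀ j, ∑' i, ν i * q i j ≤ -w j) : IsSubinvariant q ν w := fun j G hj =>
  ((hs j).sum_le_tsum G fun i hi => mul_nonneg (hν i) (hq i j fun hij => hi (hij ▸ hj))).trans (h j)

theorem truncExp_eq {E : Type*} (q : E → E → ℝ) {F : Finset E} [DecidableEq F] (t : ℝ) {i j : E}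
    (hi : i ∈ F) (hj : j ∈ F) : truncExp q F t i j =
      NormedSpace.exp (t • Matrix.of fun a b : F => q a b) ⟨i, hi⟩ ⟨j, hj⟩ := by
  rw [truncExp, dif_pos ⟨hi, hj⟩]
  congr!

theorem truncExp_of_not_mem {E : Type*} (q : E → E → ℝ) {F : Finset E} (t : ℝ) {i j : E}
    (h : ¬ (i ∈ F ∧ j ∈ F)) : truncExp q F t i j = 0 := dif_neg h

theorem sum_mul_truncExp {E : Type*} (q : E → E → ℝ) (F : Finset E) (t : ℝ) (v : E → ℝ)
    {j : E} (hj : j ∈ F) [DecidableEq F] : ∑ i ∈ F, v i * truncExp q F t i j =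
      ((fun a : F => v a) ᵥ* NormedSpace.exp (t • Matrix.of fun a b : F => q a b)) ⟨j, hj⟩ := by
  rw [← Finset.sum_coe_sort]
  refine Finset.sum_congr rfl fun a _ => ?_
  rw [truncExp_eq q t a.2 hj]

theorem sum_truncExp_mul_truncExp {E : Type*} (q : E → E → ℝ) (F : Finset E) (s t : ℝ) (i j : E) :
    ∑' k, truncExp q F s i k * truncExp q F t k j = truncExp q F (s + t) i j := by
  classical
  by_cases h : i ∈ F ∧ j ∈ F
  · rw [tsum_eq_sum (s := F), sum_mul_truncExp q F t _ h.2, truncExp_eq q _ h.1 h.2,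
      matrix_exp_add_smul, Matrix.mul_apply]
    · refine Finset.sum_congr rfl fun a _ => ?_
      exact congrArg (· * _) (truncExp_eq q s h.1 a.2)
    · intro k hk
      rw [truncExp_of_not_mem q s fun h => hk h.2, zero_mul]
  · have hz : ∀ k, truncExp q F s i k * truncExp q F t k j = 0 := fun k => by
      rcases not_and_or.1 h with h | h
      · rw [truncExp_of_not_mem q s fun h' => h h'.1, zero_mul]
      · rw [truncExp_of_not_mem q t fun h' => h h'.2, mul_zero]
    simp only [hz, tsum_zero]
    rw [truncExp_of_not_mem q _ h]

theorem truncExp_zero {E : Type*} [DecidableEq E] (q : E → E → ℝ) {F : Finset E} {i j : E}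
    (hi : i ∈ F) (hj : j ∈ F) : truncExp q F 0 i j = if i = j then 1 else 0 := by
  rw [truncExp_eq q 0 hi hj, zero_smul, NormedSpace.exp_zero, Matrix.one_apply]
  simp

theorem hasDerivAt_truncExp_zero {E : Type*} (q : E → E → ℝ) {F : Finset E} {i j : E}
    (hi : i ∈ F) (hj : j ∈ F) : HasDerivAt (fun t => truncExp q F t i j) (q i j) 0 := by
  classical
  have h := hasDerivAt_matrix_exp_apply (Matrix.of fun a b : F => q a b) 0 ⟨i, hi⟩ ⟨j, hj⟩
  rw [zero_smul, NormedSpace.exp_zero, one_mul] at h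
  refine HasDerivAt.congr_of_eventuallyEq h (Eventually.of_forall fun t => ?_)
  exact truncExp_eq q t hi hj

theorem IsSubinvariant.vecMul_le {E : Type*} {q : E → E → ℝ} {F : Finset E}
    {ν w : E → ℝ} (h : IsSubinvariant q ν w) (a : F) :
    ((fun b : F => ν b) ᵥ* Matrix.of fun a b : F => q a b) a ≤ -w a := by
  refine le_trans (le_of_eq ?_) (h a F a.2)
  exact Finset.sum_coe_sort F fun i => ν i * q i a

namespace IsMinimalKernel

variable {E : Type*} {q : E → E → ℝ} {K : ℝ≥0 → E → E → ℝ} (hK : IsMinimalKernel q K)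
include hK

theorem nonneg (t : ℝ≥0) (i j : E) : 0 ≤ K t i j :=
  (hK.trunc_nonneg ∅ t i j).trans (hK.trunc_le ∅ t i j)

theorem le_one (t : ℝ≥0) (i j : E) : K t i j ≤ 1 := by
  simpa using hK.sum_le_one t i {j}

theorem summable_row (t : ℝ≥0) (i : E) : Summable (K t i) :=
  summable_of_sum_le (hK.nonneg t i) (hK.sum_le_one t i)

/-- The semigroup law of the truncated exponentials passes to the limit by dominated convergence,
with bound `K s i`. -/
theorem hasSum_mul (s t : ℝ≥0) (i j : E) :
    HasSum (fun k => K s i k * K t k j) (K (s + t) i j) := by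
  have hnn : ∀ k, 0 ≤ K s i k * K t k j := fun k => mul_nonneg (hK.nonneg _ _ _) (hK.nonneg _ _ _)
  have hle : ∀ k, K s i k * K t k j ≤ K s i k := fun k =>
    mul_le_of_le_one_right (hK.nonneg _ _ _) (hK.le_one _ _ _)
  have hsum := (hK.summable_row s i).of_nonneg_of_le hnn hle
  have hlim := tendsto_tsum_of_dominated_convergence (𝓕 := (atTop : Filter (Finset E)))
    (f := fun F k => truncExp q F s i k * truncExp q F t k j)
    (hK.summable_row s i) (fun k => (hK.tendsto_trunc s i k).mul (hK.tendsto_trunc t k j))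
    (Eventually.of_forall fun F k => by
      rw [Real.norm_of_nonneg (mul_nonneg (hK.trunc_nonneg F s i k) (hK.trunc_nonneg F t k j))]
      exact (mul_le_mul (hK.trunc_le F s i k) (hK.trunc_le F t k j) (hK.trunc_nonneg F t k j)
        (hK.nonneg _ _ _)).trans (hle k))
  simp only [sum_truncExp_mul_truncExp] at hlim
  have h := tendsto_nhds_unique hlim (by simpa using hK.tendsto_trunc (s + t) i j)
  rw [← h]
  exact hsum.hasSum

theorem exp_nonneg (F : Finset E) [DecidableEq F] (s : ℝ) (hs : 0 ≤ s) (a b : F) :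
    0 ≤ NormedSpace.exp (s • Matrix.of fun a b : F => q a b) a b := by
  have h := hK.trunc_nonneg F ⟨s, hs⟩ a b
  rwa [truncExp_eq q _ a.2 b.2] at h

/-- Transfers bounds on finite matrices to `K`: for `F ⊇ G ∪ {j}` the sum over `G` is at most the
sum over `F`. -/
theorem le_of_eventually_trunc {ν : E → ℝ} {c : ℝ} {t : ℝ≥0} {j : E} {G : Finset E}
    (hν : ∀ i, 0 ≤ ν i) (h : ∀ F : Finset E, j ∈ F → ∑ i ∈ F, ν i * truncExp q F t i j ≤ c) :
    ∑ i ∈ G, ν i * K t i j ≤ c := by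
  classical
  refine le_of_tendsto (tendsto_finsetSum G fun i _ => (hK.tendsto_trunc t i j).const_mul (ν i)) ?_
  filter_upwards [eventually_ge_atTop (insert j G)] with F hF
  refine le_trans ?_ (h F (hF (by simp)))
  exact Finset.sum_le_sum_of_subset_of_nonneg ((Finset.subset_insert j G).trans hF)
    fun i _ _ => mul_nonneg (hν i) (hK.trunc_nonneg F t i j)

theorem sum_mul_add_le {ν w : E → ℝ} (hν : ∀ i, 0 ≤ ν i) (hw : ∀ i, 0 ≤ w i)
    (h : IsSubinvariant q ν w) (t : ℝ≥0) (j : E) (G : Finset E) :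
    ∑ i ∈ G, ν i * K t i j + t * (Real.exp (q j j * t) * w j) ≤ ν j := by
  classical
  rw [← le_sub_iff_add_le]
  refine hK.le_of_eventually_trunc hν fun F hj => ?_
  rw [le_sub_iff_add_le, sum_mul_truncExp q F t ν hj]
  exact vecMul_exp_add_le (M := Matrix.of fun a b : F => q a b) (w := fun a : F => w a)
    (fun a b hab => hK.offDiag_nonneg a b fun h => hab (Subtype.ext h))
    (fun a => hK.diag_nonpos a)
    (fun s hs a b => hK.exp_nonneg F s hs a b) (fun a => hw a) h.vecMul_le t.2 ⟨j, hj⟩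

theorem sum_add_mul_le {ν w : E → ℝ} (hν : ∀ i, 0 ≤ ν i) (hw : ∀ i, 0 ≤ w i)
    (h : IsSubinvariant q ν w) (h' : IsSubinvariant q w 0) (t : ℝ≥0) (j : E) (G : Finset E) :
    ∑ i ∈ G, (ν i + t * w i) * K t i j ≤ ν j := by
  classical
  refine hK.le_of_eventually_trunc
    (fun i => add_nonneg (hν i) (mul_nonneg t.2 (hw i))) fun F hj => ?_
  have h1 : ∑ i ∈ F, (ν i + t * w i) * truncExp q F t i j =
      ∑ i ∈ F, ν i * truncExp q F t i j + t * ∑ i ∈ F, w i * truncExp q F t i j := by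
    rw [Finset.mul_sum, ← Finset.sum_add_distrib]
    exact Finset.sum_congr rfl fun i _ => by ring
  rw [h1, sum_mul_truncExp q F t ν hj, sum_mul_truncExp q F t w hj]
  exact vecMul_exp_add_le_of_subinvariant (M := Matrix.of fun a b : F => q a b)
    (fun s hs a b => hK.exp_nonneg F s hs a b) h.vecMul_le
    (fun a => by simpa using h'.vecMul_le a) t.2 ⟨j, hj⟩

/-- A measure decaying at least at the rate `β` along small times is `β`-subinvariant for `q`. -/
theorem isSubinvariant_of_sum_le {ν : E → ℝ} (hν : ∀ i, 0 ≤ ν i) {β : ℝ} {u : ℕ → ℝ≥0}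
    (hu0 : ∀ n, 0 < u n) (hu : Tendsto u atTop (𝓝 0))
    (h : ∀ n j (G : Finset E), ∑ i ∈ G, ν i * K (u n) i j ≤ Real.exp (-β * u n) * ν j) :
    IsSubinvariant q ν fun j => β * ν j := by
  classical
  intro j G hj
  -- Because `truncExp ≤ K`, this function vanishes at `0` and is nonpositive along `u n`, so its
  -- derivative at `0` is nonpositive.
  have hd : HasDerivAt (fun t : ℝ => ∑ i ∈ G, ν i * truncExp q G t i j - Real.exp (-β * t) * ν j)
      (∑ i ∈ G, ν i * q i j - -β * ν j) 0 := by
    refine (HasDerivAt.fun_sum fun i hi =>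
      (hasDerivAt_truncExp_zero q hi hj).const_mul (ν i)).fun_sub (HasDerivAt.mul_const ?_ _)
    simpa using ((hasDerivAt_id (0 : ℝ)).const_mul (-β)).exp
  have hlim := (hasDerivAt_iff_tendsto_slope.1 hd).comp (f := fun n => (u n : ℝ)) (x := atTop)
    (tendsto_nhdsWithin_iff.2 ⟨by simpa using NNReal.tendsto_coe.2 hu,
      Eventually.of_forall fun n => by simpa using (hu0 n).ne'⟩)
  have hle := le_of_tendsto hlim (b := 0) (Eventually.of_forall fun n => by
    rw [Function.comp_apply, slope_def_field, sub_zero]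
    have h0 : ∑ i ∈ G, ν i * truncExp q G 0 i j - Real.exp (-β * 0) * ν j = 0 := by
      rw [Finset.sum_congr rfl fun i hi => by rw [truncExp_zero q hi hj]]
      simp [hj]
    rw [h0, sub_zero]
    refine div_nonpos_of_nonpos_of_nonneg (sub_nonpos.2 ?_) (u n).2
    exact (Finset.sum_le_sum fun i _ => mul_le_mul_of_nonneg_left
      (hK.trunc_le G (u n) i j) (hν i)).trans (h n j G))
  linarith

end IsMinimalKernel

/-! ### Infinite sums: masses, lifetimes and decay rates -/

/-- Tonelli: `(νA)B = ν(AB)` for nonnegative arrays. -/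
theorem hasSum_tsum_mul_mul {E : Type*} {ν B c : E → ℝ} {A : E → E → ℝ} (hν : ∀ i, 0 ≤ ν i)
    (hνs : Summable ν) (hA : ∀ i j, 0 ≤ A i j) (hA1 : ∀ i j, A i j ≤ 1) (hB : ∀ j, 0 ≤ B j)
    (hc : ∀ i, HasSum (fun j => A i j * B j) (c i)) (hc1 : ∀ i, c i ≤ 1) :
    HasSum (fun j => (∑' i, ν i * A i j) * B j) (∑' i, ν i * c i) := by
  have hc0 : ∀ i, 0 ≤ c i := fun i => (hc i).nonneg fun j => mul_nonneg (hA i j) (hB j)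
  have hrow : ∀ i, HasSum (fun j => ν i * (A i j * B j)) (ν i * c i) := fun i =>
    (hc i).mul_left (ν i)
  have hprod : Summable fun p : E × E => ν p.1 * (A p.1 p.2 * B p.2) := by
    refine (summable_prod_of_nonneg fun p =>
      mul_nonneg (hν _) (mul_nonneg (hA _ _) (hB _))).2 ⟨fun i => (hrow i).summable, ?_⟩
    simp only [fun i => (hrow i).tsum_eq]
    exact hνs.of_nonneg_of_le (fun i => mul_nonneg (hν i) (hc0 i))
      fun i => mul_le_of_le_one_right (hν i) (hc1 i)
  have h1 := hprod.hasSum.prod_fiberwise hrow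
  have h2 : HasSum (fun p : E × E => ν p.2 * (A p.2 p.1 * B p.1)) (∑' i, ν i * c i) := by
    rw [h1.tsum_eq]
    exact (Equiv.prodComm E E).hasSum_iff.2 hprod.hasSum
  refine h2.prod_fiberwise fun j => ?_
  have hs : Summable fun i => ν i * A i j :=
    hνs.of_nonneg_of_le (fun i => mul_nonneg (hν i) (hA i j))
      fun i => mul_le_of_le_one_right (hν i) (hA1 i j)
  simpa only [mul_assoc] using hs.hasSum.mul_right (B j)

theorem tendsto_one_sub_exp_div (β : ℝ) {u : ℕ → ℝ≥0} (hu0 : ∀ n, 0 < u n)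
    (hu : Tendsto u atTop (𝓝 0)) :
    Tendsto (fun n => (1 - Real.exp (-β * u n)) / u n) atTop (𝓝 β) := by
  have hd : HasDerivAt (fun t : ℝ => 1 - Real.exp (-β * t)) β 0 := by
    have h := (((hasDerivAt_id (0 : ℝ)).const_mul (-β)).exp).const_sub 1
    simpa using h
  have hlim := (hasDerivAt_iff_tendsto_slope.1 hd).comp (f := fun n => (u n : ℝ)) (x := atTop)
    (tendsto_nhdsWithin_iff.2 ⟨by simpa using NNReal.tendsto_coe.2 hu,
      Eventually.of_forall fun n => by simpa using (hu0 n).ne'⟩)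
  refine hlim.congr fun n => ?_
  rw [Function.comp_apply, slope_def_field]
  simp

theorem tendsto_one_div_succ_nnreal :
    Tendsto (fun n : ℕ => 1 / ((n : ℝ≥0) + 1)) atTop (𝓝 0) := by
  rw [← NNReal.tendsto_coe]
  push_cast
  exact tendsto_one_div_add_atTop_nhds_zero_nat

/-- The mass at time `t` of a sub-Markovian transition function started at `i`. -/
def kernelMass {E : Type*} (K : ℝ≥0 → E → E → ℝ) (t : ℝ≥0) (i : E) : ℝ := ∑' j, K t i j

namespace IsMinimalKernel

variable {E : Type*} {q : E → E → ℝ} {K : ℝ≥0 → E → E → ℝ} (hK : IsMinimalKernel q K)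
include hK

theorem hasSum_kernelMass (t : ℝ≥0) (i : E) : HasSum (K t i) (kernelMass K t i) :=
  (hK.summable_row t i).hasSum

theorem kernelMass_nonneg (t : ℝ≥0) (i : E) : 0 ≤ kernelMass K t i :=
  tsum_nonneg (hK.nonneg t i)

theorem kernelMass_le_one (t : ℝ≥0) (i : E) : kernelMass K t i ≤ 1 :=
  (hK.summable_row t i).tsum_le_of_sum_le (hK.sum_le_one t i)

theorem summable_mul_kernel {ν : E → ℝ} (hν : ∀ i, 0 ≤ ν i) (hνs : Summable ν) (t : ℝ≥0) (j : E) :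
    Summable fun i => ν i * K t i j :=
  hνs.of_nonneg_of_le (fun i => mul_nonneg (hν i) (hK.nonneg t i j))
    fun i => mul_le_of_le_one_right (hν i) (hK.le_one t i j)

theorem summable_mul_kernelMass {ν : E → ℝ} (hν : ∀ i, 0 ≤ ν i) (hνs : Summable ν) (t : ℝ≥0) :
    Summable fun i => ν i * kernelMass K t i :=
  hνs.of_nonneg_of_le (fun i => mul_nonneg (hν i) (hK.kernelMass_nonneg t i))
    fun i => mul_le_of_le_one_right (hν i) (hK.kernelMass_le_one t i)

theorem hasSum_vecMul {ν : E → ℝ} (hν : ∀ i, 0 ≤ ν i) (hνs : Summable ν) (t : ℝ≥0) :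
    HasSum (fun j => ∑' i, ν i * K t i j) (∑' i, ν i * kernelMass K t i) := by
  simpa using hasSum_tsum_mul_mul hν hνs (hK.nonneg t) (hK.le_one t) (B := fun _ => 1)
    (fun _ => zero_le_one) (fun i => by simpa using hK.hasSum_kernelMass t i)
    (hK.kernelMass_le_one t)

theorem hasSum_mul_kernelMass (s t : ℝ≥0) (i : E) :
    HasSum (fun k => K s i k * kernelMass K t k) (kernelMass K (s + t) i) := by
  have h1 := hK.hasSum_vecMul (hK.nonneg s i) (hK.summable_row s i) t
  simp only [fun j => (hK.hasSum_mul s t i j).tsum_eq] at h1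
  rw [← h1.unique (hK.hasSum_kernelMass (s + t) i)]
  exact (hK.summable_mul_kernelMass (hK.nonneg s i) (hK.summable_row s i) t).hasSum

theorem hasSum_vecMul_mul {ν : E → ℝ} (hν : ∀ i, 0 ≤ ν i) (hνs : Summable ν) (s t : ℝ≥0) (j : E) :
    HasSum (fun k => (∑' i, ν i * K s i k) * K t k j) (∑' i, ν i * K (s + t) i j) :=
  hasSum_tsum_mul_mul hν hνs (hK.nonneg s) (hK.le_one s) (fun k => hK.nonneg t k j)
    (fun i => hK.hasSum_mul s t i j) (fun i => hK.le_one _ i j)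

theorem hasSum_vecMul_mul_kernelMass {ν : E → ℝ} (hν : ∀ i, 0 ≤ ν i) (hνs : Summable ν)
    (s t : ℝ≥0) : HasSum (fun k => (∑' i, ν i * K s i k) * kernelMass K t k)
      (∑' i, ν i * kernelMass K (s + t) i) :=
  hasSum_tsum_mul_mul hν hνs (hK.nonneg s) (hK.le_one s) (hK.kernelMass_nonneg t)
    (fun i => hK.hasSum_mul_kernelMass s t i) (hK.kernelMass_le_one _)

theorem vecMul_add_le {ν w : E → ℝ} (hν : ∀ i, 0 ≤ ν i) (hνs : Summable ν) (hw : ∀ i, 0 ≤ w i)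
    (h : IsSubinvariant q ν w) (t : ℝ≥0) (j : E) :
    ∑' i, ν i * K t i j + t * (Real.exp (q j j * t) * w j) ≤ ν j := by
  rw [← le_sub_iff_add_le]
  refine (hK.summable_mul_kernel hν hνs t j).tsum_le_of_sum_le fun G => ?_
  rw [le_sub_iff_add_le]
  exact hK.sum_mul_add_le hν hw h t j G

theorem tendsto_tsum_exp_mul {w B : E → ℝ} (hw : ∀ i, 0 ≤ w i)
    (hws : Summable w) (hB : ∀ i, 0 ≤ B i) (hB1 : ∀ i, B i ≤ 1) {u : ℕ → ℝ≥0}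
    (hu : Tendsto u atTop (𝓝 0)) :
    Tendsto (fun n => ∑' i, Real.exp (q i i * u n) * w i * B i) atTop (𝓝 (∑' i, w i * B i)) := by
  refine tendsto_tsum_of_dominated_convergence (bound := w) hws (fun i => ?_)
    (Eventually.of_forall fun n i => ?_)
  · have h1 : Tendsto (fun n => q i i * (u n : ℝ)) atTop (𝓝 0) := by
      simpa using (NNReal.tendsto_coe.2 hu).const_mul (q i i)
    have h2 := (Real.continuous_exp.tendsto 0).comp h1
    rw [Real.exp_zero] at h2
    simpa using (h2.mul_const (w i)).mul_const (B i)
  · have h1 : Real.exp (q i i * u n) ≤ 1 :=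
      Real.exp_le_one_iff.2 (mul_nonpos_of_nonpos_of_nonneg (hK.diag_nonpos i) (u n).2)
    rw [Real.norm_of_nonneg (mul_nonneg (mul_nonneg (Real.exp_pos _).le (hw i)) (hB i))]
    exact (mul_le_of_le_one_right (mul_nonneg (Real.exp_pos _).le (hw i)) (hB1 i)).trans
      (mul_le_of_le_one_left (hw i) h1)

/-- If `ν` and `-α⁻¹ ν q` are probability distributions and the lifetime under `ν` is exponential
with parameter `α`, then so is the lifetime under `-α⁻¹ ν q`. -/
theorem exponential_of_isSubinvariant {ν w : E → ℝ} {α : ℝ} (hα : 0 < α) (hν : ∀ i, 0 ≤ ν i)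
    (hν1 : HasSum ν 1) (hw : ∀ i, 0 ≤ w i) (hw1 : HasSum w 1)
    (hexp : ∀ t : ℝ≥0, ∑' i, ν i * kernelMass K t i = Real.exp (-α * t))
    (h : IsSubinvariant q ν fun j => α * w j) (s : ℝ≥0) :
    ∑' i, w i * kernelMass K s i = Real.exp (-α * s) := by
  set u : ℕ → ℝ≥0 := fun n => 1 / ((n : ℝ≥0) + 1) with hu_def
  have hu0 : ∀ n, 0 < u n := fun n => by positivity
  have hu : Tendsto u atTop (𝓝 0) := tendsto_one_div_succ_nnreal
  -- The defect of the subinvariance inequality at time `u n`, paired with a test function `B`. It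
  -- is used for `B = 1` and for `B` the survival function at time `s`.
  have hkey : ∀ B : E → ℝ, (∀ i, 0 ≤ B i) → (∀ i, B i ≤ 1) → ∀ a b : ℝ, ∀ n,
      HasSum (fun i => ν i * B i) a → HasSum (fun k => (∑' i, ν i * K (u n) i k) * B k) b →
      HasSum (fun j => (ν j - ∑' i, ν i * K (u n) i j
        - u n * (Real.exp (q j j * u n) * (α * w j))) * B j)
        (a - b - u n * α * ∑' i, Real.exp (q i i * u n) * w i * B i) := by
    intro B hB hB1 a b n ha hb
    have hs : Summable fun i => Real.exp (q i i * u n) * w i * B i := by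
      refine hw1.summable.of_nonneg_of_le
        (fun i => mul_nonneg (mul_nonneg (Real.exp_pos _).le (hw i)) (hB i)) fun i => ?_
      have h1 : Real.exp (q i i * u n) ≤ 1 :=
        Real.exp_le_one_iff.2 (mul_nonpos_of_nonpos_of_nonneg (hK.diag_nonpos i) (u n).2)
      exact (mul_le_of_le_one_right (mul_nonneg (Real.exp_pos _).le (hw i)) (hB1 i)).trans
        (mul_le_of_le_one_left (hw i) h1)
    refine ((ha.sub hb).sub (hs.hasSum.mul_left (u n * α : ℝ))).congr_fun ?_
    intro j
    ring
  have hpos : ∀ n j, 0 ≤ ν j - ∑' i, ν i * K (u n) i j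
        - u n * (Real.exp (q j j * u n) * (α * w j)) := fun n j => by
    have := hK.vecMul_add_le hν hν1.summable (fun i => mul_nonneg hα.le (hw i)) h (u n) j
    linarith
  have h1 : ∀ n, HasSum _ _ := fun n => hkey (fun _ => 1) (fun _ => zero_le_one) (fun _ => le_rfl)
    1 (Real.exp (-α * u n)) n (by simpa using hν1) (by
      rw [← hexp (u n)]
      simpa using hK.hasSum_vecMul hν hν1.summable (u n))
  have h2 : ∀ n, HasSum _ _ := fun n => hkey (kernelMass K s) (hK.kernelMass_nonneg s)
    (hK.kernelMass_le_one s) (Real.exp (-α * s)) (Real.exp (-α * (u n + s : ℝ≥0))) n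
    (by
      rw [← hexp s]
      exact (hK.summable_mul_kernelMass hν hν1.summable s).hasSum)
    (by
      rw [← hexp (u n + s)]
      exact hK.hasSum_vecMul_mul_kernelMass hν hν1.summable (u n) s)
  have hd1 : ∀ n, 0 ≤ Real.exp (-α * s) * ((1 - Real.exp (-α * u n)) / u n) -
      α * ∑' i, Real.exp (q i i * u n) * w i * kernelMass K s i := fun n => by
    have h3 := (h2 n).nonneg fun j => mul_nonneg (hpos n j) (hK.kernelMass_nonneg s j)
    have h4 : Real.exp (-α * (u n + s : ℝ≥0)) = Real.exp (-α * u n) * Real.exp (-α * s) := by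
      rw [← Real.exp_add]; push_cast; ring_nf
    have hun : (0 : ℝ) < u n := hu0 n
    rw [h4] at h3
    rw [← mul_nonneg_iff_of_pos_left hun]
    refine h3.trans (le_of_eq ?_)
    field_simp
  have hd2 : ∀ n, Real.exp (-α * s) * ((1 - Real.exp (-α * u n)) / u n) -
      α * ∑' i, Real.exp (q i i * u n) * w i * kernelMass K s i ≤
      (1 - Real.exp (-α * u n)) / u n - α * ∑' i, Real.exp (q i i * u n) * w i * 1 := fun n => by
    have h3 := hasSum_le (fun j => mul_le_mul_of_nonneg_left (hK.kernelMass_le_one s j)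
      (hpos n j)) (h2 n) (h1 n)
    have h4 : Real.exp (-α * (u n + s : ℝ≥0)) = Real.exp (-α * u n) * Real.exp (-α * s) := by
      rw [← Real.exp_add]; push_cast; ring_nf
    have hun : (0 : ℝ) < u n := hu0 n
    rw [h4] at h3
    rw [← mul_le_mul_iff_right₀ hun]
    refine le_trans (le_of_eq ?_) (h3.trans (le_of_eq ?_)) <;> field_simp
  have hq := tendsto_one_sub_exp_div α hu0 hu
  have hl1 := (hq.const_mul (Real.exp (-α * s))).sub
    ((hK.tendsto_tsum_exp_mul hw hw1.summable (hK.kernelMass_nonneg s)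
      (hK.kernelMass_le_one s) hu).const_mul α)
  have hl2 := hq.sub ((hK.tendsto_tsum_exp_mul hw hw1.summable (B := fun _ => 1)
    (fun _ => zero_le_one) (fun _ => le_rfl) hu).const_mul α)
  have e1 := ge_of_tendsto' hl1 hd1
  -- Divided by `u n`, the pairing with `B = 1` tends to `α - α = 0` and squeezes the other pairing.
  have e2 := le_of_tendsto_of_tendsto' hl1 hl2 hd2
  simp only [mul_one, hw1.tsum_eq, sub_self] at e2
  have e3 : α * (Real.exp (-α * s) - ∑' i, w i * kernelMass K s i) = 0 := by linarith
  rcases mul_eq_zero.1 e3 with e | e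
  · exact absurd e hα.ne'
  · linarith

/-- An `α`-subinvariant distribution with exponential lifetime of parameter `α` is
`α`-invariant. -/
theorem vecMul_eq_of_isSubinvariant {ν : E → ℝ} {α : ℝ} (hα : 0 < α) (hν : ∀ i, 0 ≤ ν i)
    (hν1 : HasSum ν 1) (hexp : ∀ t : ℝ≥0, ∑' i, ν i * kernelMass K t i = Real.exp (-α * t))
    (h : IsSubinvariant q ν fun j => α * ν j) (t : ℝ≥0) (j : E) :
    ∑' i, ν i * K t i j = Real.exp (-α * t) * ν j := by
  have hαν : ∀ i, 0 ≤ α * ν i := fun i => mul_nonneg hα.le (hν i)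
  have h0 : IsSubinvariant q (fun j => α * ν j) 0 := fun j G hj => by
    have h1 := mul_le_mul_of_nonneg_left (h j G hj) hα.le
    rw [Finset.mul_sum] at h1
    simp only [Pi.zero_apply, neg_zero, mul_assoc]
    exact h1.trans (mul_nonpos_of_nonneg_of_nonpos hα.le (neg_nonpos.2 (hαν j)))
  have hsum := fun (s : ℝ≥0) k => hK.summable_mul_kernel hν hν1.summable s k
  have hstep : ∀ (s : ℝ≥0) k, (1 + α * s) * ∑' i, ν i * K s i k ≤ ν k := fun s k => by
    rw [← tsum_mul_left]
    refine ((hsum s k).mul_left _).tsum_le_of_sum_le fun G => ?_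
    refine le_trans (le_of_eq ?_) (hK.sum_add_mul_le hν hαν h h0 s k G)
    exact Finset.sum_congr rfl fun i _ => by ring
  -- With `s = t / (n + 1)` the constant `(1 + α s) ^ (n + 1)` tends to `exp(αt)`.
  have hiter : ∀ (s : ℝ≥0) (n : ℕ) k,
      (1 + α * s) ^ (n + 1) * ∑' i, ν i * K ((n + 1) * s) i k ≤ ν k := by
    intro s n
    induction n with
    | zero => simpa using hstep s
    | succ n ih =>
      intro k
      have h1 := hK.hasSum_vecMul_mul hν hν1.summable s ((n + 1) * s) k
      have h2 : s + ((n : ℝ≥0) + 1) * s = ((n + 1 : ℕ) + 1) * s := by push_cast; ring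
      rw [h2] at h1
      have hs : (0 : ℝ) ≤ 1 + α * s := by positivity
      have h3 := hasSum_le (fun i => (by
        rw [← mul_assoc]
        exact mul_le_mul_of_nonneg_right (hstep s i) (hK.nonneg ((n + 1) * s) i k) :
          (1 + α * s) * ((∑' l, ν l * K s l i) * K ((n + 1) * s) i k) ≤
            ν i * K ((n + 1) * s) i k)) (h1.mul_left (1 + α * s)) (hsum ((n + 1) * s) k).hasSum
      calc _ = (1 + α * s) ^ (n + 1) *
            ((1 + α * s) * ∑' i, ν i * K (((n + 1 : ℕ) + 1) * s) i k) := by rw [pow_succ]; ring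
        _ ≤ (1 + α * s) ^ (n + 1) * ∑' i, ν i * K ((n + 1) * s) i k := by gcongr
        _ ≤ ν k := ih k
  have hle : ∀ k, Real.exp (α * t) * ∑' i, ν i * K t i k ≤ ν k := fun k => by
    have hl := ((Real.tendsto_one_add_div_pow_exp (α * t)).comp
      (tendsto_add_atTop_nat 1)).mul_const (∑' i, ν i * K t i k)
    refine le_of_tendsto' hl fun n => ?_
    have h1 := hiter (t / (n + 1)) n k
    rw [mul_div_cancel₀ _ (by positivity)] at h1
    refine le_trans (le_of_eq ?_) h1
    simp only [Function.comp_apply]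
    push_cast
    rw [mul_div_assoc]
  -- The vector `ν - exp(αt) ν K_t` is nonnegative with total mass `0`, so it vanishes.
  have hz := hν1.sub ((hK.hasSum_vecMul hν hν1.summable t).mul_left (Real.exp (α * t)))
  rw [hexp, ← Real.exp_add, neg_mul, add_neg_cancel, Real.exp_zero, sub_self] at hz
  have hz' := congrFun ((hasSum_zero_iff_of_nonneg fun k => sub_nonneg.2 (hle k)).1 hz) j
  have hz'' : ν j = Real.exp (α * t) * ∑' i, ν i * K t i j := sub_eq_zero.1 hz'
  rw [hz'', ← mul_assoc, ← Real.exp_add, neg_mul, neg_add_cancel, Real.exp_zero, one_mul]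

/-- The rate of decay of a measure along small times is read off from its image under `q`. -/
theorem mul_eq_mul_of_decay {ν w : E → ℝ} {α β : ℝ} (hβ : 0 ≤ β) (hν : ∀ i, 0 ≤ ν i)
    (hνs : Summable ν) (hs : ∀ j, Summable fun i => ν i * q i j)
    (hw : ∀ j, ∑' i, ν i * q i j = -(α * w j)) {u : ℕ → ℝ≥0} (hu0 : ∀ n, 0 < u n)
    (hu : Tendsto u atTop (𝓝 0))
    (h : ∀ n j, ∑' i, ν i * K (u n) i j = Real.exp (-β * u n) * ν j) (j : E) :
    α * w j = β * ν j := by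
  have hsub := hK.isSubinvariant_of_sum_le hν hu0 hu fun n j G =>
    ((hK.summable_mul_kernel hν hνs (u n) j).sum_le_tsum G fun i _ =>
      mul_nonneg (hν i) (hK.nonneg _ _ _)).trans (h n j).le
  have hge : ∀ k, β * ν k ≤ α * w k := fun k => by
    classical
    have h1 := le_of_tendsto (hs k).hasSum (by
      filter_upwards [eventually_ge_atTop {k}] with G hG using hsub k G (hG (by simp)))
    rw [hw k] at h1
    linarith
  refine le_antisymm ?_ (hge j)
  have hαw : ∀ k, 0 ≤ α * w k := fun k => (mul_nonneg hβ (hν k)).trans (hge k)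
  have hsub' : IsSubinvariant q ν fun k => α * w k :=
    isSubinvariant_of_summable hK.offDiag_nonneg hν hs fun k => (hw k).le
  have hl1 : Tendsto (fun n => Real.exp (q j j * u n) * (α * w j)) atTop (𝓝 (1 * (α * w j))) := by
    have h1 : Tendsto (fun n => q j j * (u n : ℝ)) atTop (𝓝 0) := by
      simpa using (NNReal.tendsto_coe.2 hu).const_mul (q j j)
    have h2 := (Real.continuous_exp.tendsto 0).comp h1
    rw [Real.exp_zero] at h2
    exact h2.mul_const _
  rw [one_mul] at hl1
  refine le_of_tendsto_of_tendsto' hl1 ((tendsto_one_sub_exp_div β hu0 hu).mul_const (ν j))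
    fun n => ?_
  -- This reads `exp(-βu) ν_j + u exp(q_jj u) α w_j ≤ ν_j`; dividing by `u` and letting `u → 0`
  -- gives `α w_j ≤ β ν_j`.
  have h1 := hK.vecMul_add_le hν hνs hαw hsub' (u n) j
  have hun : (0 : ℝ) < u n := hu0 n
  rw [h n j] at h1
  rw [← mul_le_mul_iff_right₀ hun]
  refine le_trans (le_sub_iff_add_le'.2 h1) (le_of_eq ?_)
  field_simp

end IsMinimalKernel

/-! ### Sequences with `ν n q = -α ν (n + 1)` -/

namespace IsMinimalKernel

variable {E : Type*} {q : E → E → ℝ} {K : ℝ≥0 → E → E → ℝ} (hK : IsMinimalKernel q K)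
  {α : ℝ} {ν : ℕ → E → ℝ}
include hK

theorem isSubinvariant_succ {n : ℕ} (hs : ∀ n j, Summable fun i => ν n i * q i j)
    (hrec : ∀ n j, ∑' i, ν n i * q i j = -(α * ν (n + 1) j)) (hν : ∀ i, 0 ≤ ν n i) :
    IsSubinvariant q (ν n) fun j => α * ν (n + 1) j :=
  isSubinvariant_of_summable hK.offDiag_nonneg hν (hs n) fun j => (hrec n j).le

theorem exponential_seq (hα : 0 < α) (hs : ∀ n j, Summable fun i => ν n i * q i j)
    (hrec : ∀ n j, ∑' i, ν n i * q i j = -(α * ν (n + 1) j))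
    (hexp : ∀ t : ℝ≥0, ∑' i, ν 0 i * kernelMass K t i = Real.exp (-α * t)) {n : ℕ}
    (h : ∀ m ≤ n, (∀ i, 0 ≤ ν m i) ∧ HasSum (ν m) 1) (t : ℝ≥0) :
    ∑' i, ν n i * kernelMass K t i = Real.exp (-α * t) := by
  induction n generalizing t with
  | zero => exact hexp t
  | succ n ih =>
    have h1 := h n n.le_succ
    have h2 := h (n + 1) le_rfl
    exact hK.exponential_of_isSubinvariant hα h1.1 h1.2 h2.1 h2.2
      (fun t => ih (fun m hm => h m (hm.trans n.le_succ)) t)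
      (hK.isSubinvariant_succ hs hrec h1.1) t

theorem tsum_mul_kernelMass_eq {ν : E → ℝ} (hν : ∀ i, 0 ≤ ν i) (hν1 : HasSum ν 1) {h : ℝ≥0 → ℝ}
    (hqs : ∀ t j, ∑' i, ν i * K t i j = h t * ν j) (t : ℝ≥0) :
    ∑' i, ν i * kernelMass K t i = h t := by
  have h1 := hK.hasSum_vecMul hν hν1.summable t
  simp only [hqs] at h1
  simpa using h1.unique (hν1.mul_left (h t))

/-- The survival function of a quasi-stationary distribution is multiplicative. -/
theorem decay_mul {ν : E → ℝ} (hν : ∀ i, 0 ≤ ν i) (hν1 : HasSum ν 1) {h : ℝ≥0 → ℝ}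
    (hqs : ∀ t j, ∑' i, ν i * K t i j = h t * ν j) (s t : ℝ≥0) : h (s + t) = h s * h t := by
  have hmass := hK.tsum_mul_kernelMass_eq hν hν1 hqs
  have h1 := hK.hasSum_vecMul_mul_kernelMass hν hν1.summable s t
  simp only [hqs, hmass, mul_assoc] at h1
  have h2 := (hK.summable_mul_kernelMass hν hν1.summable t).hasSum.mul_left (h s)
  rw [hmass] at h2
  exact h1.unique h2

/-- If `ν n` is quasi-stationary and the entries of all `ν m` lie in `[0, 1]`, then
`ν (n + 1) = ν n`. -/
theorem succ_eq_of_bounded (hα : 0 < α) (hs : ∀ n j, Summable fun i => ν n i * q i j)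
    (hrec : ∀ n j, ∑' i, ν n i * q i j = -(α * ν (n + 1) j)) (h0 : HasSum (ν 0) 1)
    (hexp : ∀ t : ℝ≥0, ∑' i, ν 0 i * kernelMass K t i = Real.exp (-α * t))
    (hpos : ∀ m i, 0 ≤ ν m i) (hle : ∀ m i, ν m i ≤ 1) {n : ℕ} (hn : HasSum (ν n) 1) {h : ℝ≥0 → ℝ}
    (hh : ∀ t, 0 < h t) (hqs : ∀ t j, ∑' i, ν n i * K t i j = h t * ν n j) (j : E) :
    ν (n + 1) j = ν n j := by
  have hmul := hK.decay_mul (hpos n) hn hqs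
  have hmass := hK.tsum_mul_kernelMass_eq (hpos n) hn hqs
  have hle1 : h 1 ≤ 1 := by
    rw [← hmass 1, ← hn.tsum_eq]
    exact (hK.summable_mul_kernelMass (hpos n) hn.summable 1).tsum_le_tsum
      (fun i => mul_le_of_le_one_right (hpos n i) (hK.kernelMass_le_one 1 i)) hn.summable
  -- Multiplicativity fixes `h` at the times `1 / (k + 1)` as `exp(-β / (k + 1))`; these times tend
  -- to `0`, which is all that `mul_eq_mul_of_decay` needs.
  set β : ℝ := -Real.log (h 1) with hβ_def
  have hβ : 0 ≤ β := neg_nonneg.2 (Real.log_nonpos (hh 1).le hle1)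
  have hpow : ∀ (s : ℝ≥0) (k : ℕ), h ((k + 1) * s) = h s ^ (k + 1) := fun s k => by
    induction k with
    | zero => simp
    | succ k ih =>
      rw [pow_succ, ← ih, ← hmul]
      push_cast
      ring_nf
  have hsmall : ∀ k : ℕ, h (1 / ((k : ℝ≥0) + 1)) =
      Real.exp (-β * (1 / ((k : ℝ≥0) + 1) : ℝ≥0)) := fun k => by
    have h1 := hpow (1 / ((k : ℝ≥0) + 1)) k
    rw [mul_one_div_cancel (by positivity)] at h1
    have h2 := congrArg Real.log h1
    rw [Real.log_pow] at h2
    rw [hβ_def, neg_neg, h2]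
    push_cast
    rw [mul_right_comm, mul_one_div_cancel (by positivity), one_mul, Real.exp_log (hh _)]
  have hstep : ∀ j, α * ν (n + 1) j = β * ν n j :=
    hK.mul_eq_mul_of_decay hβ (hpos n) hn.summable (hs n) (hrec n)
      (u := fun k : ℕ => 1 / ((k : ℝ≥0) + 1)) (fun k => by positivity)
      tendsto_one_div_succ_nnreal fun k j => by rw [hqs, hsmall]
  -- the sequence grows like a power of `β / α`
  have hgeom : ∀ k j, ν (n + k) j = (β / α) ^ k * ν n j := by
    intro k
    induction k with
    | zero => simp
    | succ k ih =>
      intro j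
      have h1 := hrec (n + k) j
      simp only [ih, mul_assoc, tsum_mul_left, hrec n, hstep] at h1
      rw [← add_assoc]
      have h2 : α * ν (n + k + 1) j = (β / α) ^ k * (β * ν n j) := by linarith
      rw [pow_succ]
      field_simp
      rw [mul_comm, h2]
      ring
  obtain ⟨j₀, hj₀⟩ : ∃ j, 0 < ν n j := by
    by_contra! hcon
    have hz : ν n = 0 := funext fun i => le_antisymm (hcon i) (hpos n i)
    rw [hz] at hn
    exact zero_ne_one (hasSum_zero.unique hn)
  -- Otherwise a positive entry of `ν n` would grow geometrically past the bound `1`.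
  have hβα : β ≤ α := by
    by_contra! hlt
    have h1 : 1 < β / α := (one_lt_div hα).2 hlt
    obtain ⟨k, hk⟩ := ((tendsto_pow_atTop_atTop_of_one_lt h1).atTop_mul_const hj₀).eventually_gt_atTop
      1 |>.exists
    rw [← hgeom] at hk
    exact absurd (hle _ _) (not_le.2 hk)
  -- `ν 0` dominates a multiple of `ν n`
  have hdom : ∀ k ≤ n, ∃ c > 0, ∀ j, c * ν n j ≤ ν (n - k) j := by
    intro k
    induction k with
    | zero => exact fun _ => ⟨1, one_pos, fun j => by simp⟩
    | succ k ih =>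
      intro hk
      obtain ⟨c, hc, hcj⟩ := ih (by omega)
      have e : n - (k + 1) + 1 = n - k := by omega
      -- With `w = α c ν n`, `sum_add_mul_le` at time `1` gives `w K_1 ≤ ν (n - (k + 1))`, and `w
      -- K_1 = α c h(1) ν n` by quasi-stationarity.
      refine ⟨α * c * h 1, by have := hh 1; positivity, fun j => ?_⟩
      have h1 : IsSubinvariant q (ν (n - (k + 1))) fun j => α * c * ν n j := fun j G hj => by
        refine (hK.isSubinvariant_succ hs hrec (hpos _) j G hj).trans ?_
        rw [e, neg_le_neg_iff]
        change α * c * ν n j ≤ α * ν (n - k) j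
        rw [mul_assoc]
        exact mul_le_mul_of_nonneg_left (hcj j) hα.le
      have h2 : IsSubinvariant q (fun j => α * c * ν n j) 0 := fun j G hj => by
        have h3 := mul_le_mul_of_nonneg_left (hK.isSubinvariant_succ hs hrec (hpos n) j G hj)
          (by positivity : 0 ≤ α * c)
        rw [Finset.mul_sum] at h3
        simp only [Pi.zero_apply, neg_zero, mul_assoc] at h3 ⊢
        refine h3.trans ?_
        have := hpos (n + 1) j
        have : 0 ≤ α * (c * (α * ν (n + 1) j)) := by positivity
        linarith
      have hw : ∀ i, 0 ≤ α * c * ν n i := fun i => by have := hpos n i; positivity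
      have h4 := fun G => hK.sum_add_mul_le (hpos _) hw h1 h2 1 j G
      have h5 : α * c * h 1 * ν n j = ∑' i, α * c * ν n i * K 1 i j := by
        simp only [mul_assoc, tsum_mul_left, hqs]
      rw [h5]
      refine (hK.summable_mul_kernel hw (hn.summable.mul_left _) 1 j).tsum_le_of_sum_le
        fun G => (Finset.sum_le_sum fun i _ => ?_).trans (h4 G)
      refine mul_le_mul_of_nonneg_right ?_ (hK.nonneg _ _ _)
      simpa using hpos (n - (k + 1)) i
  obtain ⟨c, hc, hcj⟩ := hdom n le_rfl
  rw [Nat.sub_self] at hcj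
  have hαβ : α ≤ β := by
    by_contra! hlt
    -- Comparing survival at time `k + 1` under `c ν n ≤ ν 0`: `c exp(-β(k + 1)) ≤ exp(-α(k + 1))`.
    have hk : ∀ k : ℕ, c * Real.exp ((α - β) * (k + 1)) ≤ 1 := fun k => by
      have h1 : c * h ((k + 1) * 1) ≤ Real.exp (-α * ((k + 1) * 1 : ℝ≥0)) := by
        rw [← hexp, ← hmass, ← tsum_mul_left]
        refine ((hK.summable_mul_kernelMass (hpos n) hn.summable _).mul_left c).tsum_le_tsum
          (fun i => ?_) (hK.summable_mul_kernelMass (hpos 0) h0.summable _)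
        rw [← mul_assoc]
        exact mul_le_mul_of_nonneg_right (hcj i) (hK.kernelMass_nonneg _ i)
      have h2 : h 1 = Real.exp (-β) := by rw [hβ_def, neg_neg, Real.exp_log (hh 1)]
      rw [hpow, h2, ← Real.exp_nat_mul] at h1
      have h3 := mul_le_mul_of_nonneg_left h1 (Real.exp_pos (α * (k + 1))).le
      rw [mul_left_comm, ← Real.exp_add, ← Real.exp_add] at h3
      push_cast at h3
      have e1 : α * ((k : ℝ) + 1) + (k + 1) * -β = (α - β) * (k + 1) := by ring
      have e2 : α * ((k : ℝ) + 1) + -α * ((k + 1) * 1) = 0 := by ring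
      rwa [e1, e2, Real.exp_zero] at h3
    have hlim : Tendsto (fun k : ℕ => c * Real.exp ((α - β) * (k + 1))) atTop atTop := by
      refine (Real.tendsto_exp_atTop.comp ?_).const_mul_atTop hc
      exact (tendsto_atTop_add_const_right _ _ tendsto_natCast_atTop_atTop).const_mul_atTop
        (sub_pos.2 hlt)
    obtain ⟨k, hk'⟩ := (hlim.eventually_gt_atTop 1).exists
    exact absurd (hk k) (not_le.2 hk')
  have h1 := hstep j
  rw [le_antisymm hβα hαβ] at h1
  exact mul_left_cancel₀ hα.ne' h1

/-- The exponential lifetime propagates from `ν 0` to `ν n`, so the decay rate of `ν n` is `α`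
itself. -/
theorem succ_eq_of_distributions (hα : 0 < α) (hs : ∀ n j, Summable fun i => ν n i * q i j)
    (hrec : ∀ n j, ∑' i, ν n i * q i j = -(α * ν (n + 1) j))
    (hexp : ∀ t : ℝ≥0, ∑' i, ν 0 i * kernelMass K t i = Real.exp (-α * t)) {n : ℕ}
    (hdist : ∀ m ≤ n, (∀ i, 0 ≤ ν m i) ∧ HasSum (ν m) 1) {h : ℝ≥0 → ℝ}
    (hqs : ∀ t j, ∑' i, ν n i * K t i j = h t * ν n j) (j : E) : ν (n + 1) j = ν n j := by
  have hn := hdist n le_rfl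
  have hmass := hK.tsum_mul_kernelMass_eq hn.1 hn.2 hqs
  have hh : ∀ t, h t = Real.exp (-α * t) := fun t => by
    rw [← hmass, hK.exponential_seq hα hs hrec hexp hdist]
  exact mul_left_cancel₀ hα.ne' (hK.mul_eq_mul_of_decay hα.le hn.1 hn.2.summable (hs n) (hrec n)
      (u := fun k : ℕ => 1 / ((k : ℝ≥0) + 1)) (fun k => by positivity)
      tendsto_one_div_succ_nnreal (fun k j => by rw [hqs, hh]) j)

theorem vecMul_limit_eq (hα : 0 < α) (hs : ∀ n j, Summable fun i => ν n i * q i j)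
    (hrec : ∀ n j, ∑' i, ν n i * q i j = -(α * ν (n + 1) j))
    (hexp : ∀ t : ℝ≥0, ∑' i, ν 0 i * kernelMass K t i = Real.exp (-α * t))
    (hdist : ∀ m, (∀ i, 0 ≤ ν m i) ∧ HasSum (ν m) 1) {w : E → ℝ} (hw : ∀ i, 0 ≤ w i)
    (hw1 : HasSum w 1) (hlim : ∀ i, Tendsto (fun n => ν n i) atTop (𝓝 (w i))) :
    (∀ t : ℝ≥0, ∑' i, w i * kernelMass K t i = Real.exp (-α * t)) ∧
    ∀ (t : ℝ≥0) j, ∑' i, w i * K t i j = Real.exp (-α * t) * w j := by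
  have hexpn : ∀ (n : ℕ) (t : ℝ≥0), ∑' i, ν n i * kernelMass K t i = Real.exp (-α * t) :=
    fun n => hK.exponential_seq hα hs hrec hexp fun m _ => hdist m
  -- Fatou's lemma. It is applied to the survival function and to one minus it; as `w` has mass `1`,
  -- the two bounds force equality.
  have hlt : ∀ (B : E → ℝ), (∀ i, 0 ≤ B i) → ∀ c, (∀ n, HasSum (fun i => ν n i * B i) c) →
      ∀ d, HasSum (fun i => w i * B i) d → d ≤ c := fun B hB c hc d hd => by
    refine le_of_tendsto' hd fun G => ?_
    refine le_of_tendsto' (tendsto_finsetSum G fun i _ => (hlim i).mul_const (B i)) fun n => ?_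
    exact sum_le_hasSum G (fun i _ => mul_nonneg ((hdist n).1 i) (hB i)) (hc n)
  have hmass : ∀ t : ℝ≥0, ∑' i, w i * kernelMass K t i = Real.exp (-α * t) := fun t => by
    have hn : ∀ n, HasSum (fun i => ν n i * kernelMass K t i) (Real.exp (-α * t)) := fun n => by
      rw [← hexpn n t]
      exact (hK.summable_mul_kernelMass (hdist n).1 (hdist n).2.summable t).hasSum
    have hwt := (hK.summable_mul_kernelMass hw hw1.summable t).hasSum
    have h1 := hlt _ (hK.kernelMass_nonneg t) _ hn _ hwt
    have h2 := hlt (fun i => 1 - kernelMass K t i)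
      (fun i => sub_nonneg.2 (hK.kernelMass_le_one t i)) (1 - Real.exp (-α * t))
      (fun n => by simpa [mul_sub] using (hdist n).2.sub (hn n)) _
      (by simpa [mul_sub] using hw1.sub hwt)
    linarith
  refine ⟨hmass, hK.vecMul_eq_of_isSubinvariant hα hw hw1 hmass fun j G hj => ?_⟩
  refine le_of_tendsto_of_tendsto' (tendsto_finsetSum G fun i _ => (hlim i).mul_const (q i j))
    (((((tendsto_add_atTop_iff_nat 1).2 (hlim j)).const_mul α)).neg) fun n => ?_
  exact hK.isSubinvariant_succ hs hrec (hdist n).1 j G hj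

end IsMinimalKernel

theorem hasSum_option_some {ι : Type*} {f : Option ι → ℝ} (h : f none = 0) {a : ℝ} :
    HasSum (fun i => f (some i)) a ↔ HasSum f a := by
  refine (Option.some_injective ι).hasSum_iff fun x hx => ?_
  cases x with
  | none => exact h
  | some i => exact absurd ⟨i, rfl⟩ hx

/-! ### Conditional laws in terms of the killed kernel -/

namespace CTMarkovChain

variable {S Ω : Type*} [MeasurableSpace Ω] (C : CTMarkovChain S Ω) {D : Set S}

/-- A countable sum of measures is evaluated termwise on every set, so `A` need not be measurable.
-/
theorem initLaw_real [Countable S] {μ : Killed D → ℝ} (hμ : ∀ i, 0 ≤ μ i) (A : Set Ω) :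
    (C.initLaw D μ).real A = ∑' i : {i : S // i ∉ D}, μ (some i) * (C.P i).real A := by
  rw [measureReal_def, initLaw, Measure.sum_apply_of_countable]
  rw [ENNReal.tsum_toReal_eq fun i => by
    rw [Measure.smul_apply, smul_eq_mul]
    exact ENNReal.mul_ne_top ENNReal.ofReal_ne_top (measure_ne_top _ _)]
  refine tsum_congr fun i => ?_
  rw [Measure.smul_apply, smul_eq_mul, ENNReal.toReal_mul, ENNReal.toReal_ofReal (hμ _),
    measureReal_def]

theorem kernelMass_subKernel [Countable S] (t : ℝ≥0) (i : {i : S // i ∉ D}) :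
    kernelMass (C.subKernel D) t i = C.survivalFrom D t i :=
  (C.hasSum_subKernel D t i).tsum_eq

theorem survival_eq_tsum [Countable S] {μ : Killed D → ℝ} (hμ : ∀ i, 0 ≤ μ i) (t : ℝ≥0) :
    C.survival D μ t = ∑' i, μ (some i) * kernelMass (C.subKernel D) t i := by
  simp only [C.kernelMass_subKernel]
  exact C.initLaw_real hμ _

theorem condLaw_some [Countable S] {μ : Killed D → ℝ} (hμ : ∀ i, 0 ≤ μ i) (t : ℝ≥0)
    (j : {i : S // i ∉ D}) : C.condLaw D μ t (some j) =
      (∑' i, μ (some i) * C.subKernel D t i j) / C.survival D μ t := by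
  have h : {ω | C.killed D t ω = some j ∧ (t : ℝ≥0∞) < C.hit D ω} =
      {ω | C.killed D t ω = some j} := by
    ext ω
    exact and_iff_left_of_imp fun h => (C.killed_eq_some_iff.1 h).1
  rw [condLaw, h, C.initLaw_real hμ]
  rfl

theorem condLaw_none {μ : Killed D → ℝ} (t : ℝ≥0) : C.condLaw D μ t none = 0 := by
  have h : {ω | C.killed D t ω = none ∧ (t : ℝ≥0∞) < C.hit D ω} = ∅ :=
    eq_empty_iff_forall_notMem.2 fun ω h => C.killed_eq_none_iff.1 h.1 h.2
  rw [condLaw, h, measureReal_empty, zero_div]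

variable {C} in
theorem IsQuasiStationary.survival_pos {μ : Killed D → ℝ}
    (h : C.IsQuasiStationary D μ) (t : ℝ≥0) : 0 < C.survival D μ t := by
  refine lt_of_le_of_ne measureReal_nonneg fun h0 => ?_
  -- If survival had probability `0`, the conditional law would be `0` by the convention `x / 0 =
  -- 0`.
  have hz : μ = 0 := funext fun i => by
    rw [← h.2 t i, condLaw, ← h0, div_zero, Pi.zero_apply]
  have h1 := h.1.2.1
  rw [hz] at h1
  exact zero_ne_one (hasSum_zero.unique h1)

variable {C} in
theorem IsQuasiStationary.tsum_eq [Countable S] {μ : Killed D → ℝ} (h : C.IsQuasiStationary D μ)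
    (t : ℝ≥0) (j : {i : S // i ∉ D}) :
    ∑' i, μ (some i) * C.subKernel D t i j = C.survival D μ t * μ (some j) := by
  rw [← h.2 t (some j), C.condLaw_some h.1.1, mul_div_cancel₀ _ (h.survival_pos t).ne']

end CTMarkovChain

/-! ### The recurrence for `muSeq` -/

section Powers

open CTMarkovChain

variable {S : Type*} {q : S → S → ℝ} {D : Set S} {μ : Killed D → ℝ} {α : ℝ}

/-- Fubini for the absolutely convergent double series gives `(μ Qⁿ) Q = μ Qⁿ⁺¹`; the term at `Δ`
drops out because that row of `killedQ` is zero. -/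
theorem muSeq_recurrence (hα : 0 < α) (hconv : PowersConverge q D μ) (n : ℕ)
    (j : {i : S // i ∉ D}) :
    HasSum (fun i : {i : S // i ∉ D} => muSeq q D μ α n (some i) * q i j)
      (-(α * muSeq q D μ α (n + 1) (some j))) := by
  have hs := hconv n j
  have h1 : HasSum (fun k => (∑' i, μ i * matPow (killedQ q D) n i k) * killedQ q D k (some j))
      (∑' i, μ i * matPow (killedQ q D) (n + 1) i (some j)) := by
    have h2 := hs.prod_symm.prod
    simp only [Prod.swap, tsum_mul_right] at h2
    have h3 := Summable.tsum_comm
      (f := fun i k => μ i * matPow (killedQ q D) n i k * killedQ q D k (some j)) hs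
    simp only [tsum_mul_right] at h3
    have h4 : ∀ i, ∑' k, μ i * matPow (killedQ q D) n i k * killedQ q D k (some j) =
        μ i * matPow (killedQ q D) (n + 1) i (some j) := fun i => by
      simp only [mul_assoc, tsum_mul_left]
      rfl
    simp only [h4] at h3
    rw [← h3]
    exact h2.hasSum
  rw [← hasSum_option_some (by simp [killedQ])] at h1
  have h5 := h1.mul_left ((-1) ^ n / α ^ n)
  have h6 : (-1) ^ n / α ^ n * (∑' i, μ i * matPow (killedQ q D) (n + 1) i (some j)) =
      -(α * muSeq q D μ α (n + 1) (some j)) := by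
    simp only [muSeq]
    rw [pow_succ, pow_succ]
    field_simp
  rw [h6] at h5
  refine h5.congr_fun fun i => ?_
  simp only [muSeq, killedQ]
  ring

theorem muSeq_zero (j : {i : S // i ∉ D}) : muSeq q D μ α 0 (some j) = μ (some j) := by
  simp [muSeq, matPow]

theorem PowerBounds.muSeq_mem_Icc (hα : 0 < α) {n : ℕ} (h : PowerBounds q D μ α n)
    (j : {i : S // i ∉ D}) : muSeq q D μ α n (some j) ∈ Icc (0 : ℝ) 1 := by
  have hpos : 0 < α ^ n := pow_pos hα n
  simp only [muSeq]
  rw [div_mul_eq_mul_div]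
  exact ⟨div_nonneg (h j).1 hpos.le, (div_le_one hpos).2 (h j).2⟩

theorem IsDistribution.some_nonneg_hasSum (h : IsDistribution μ) :
    (∀ i, 0 ≤ μ (some i)) ∧ HasSum (fun i => μ (some i)) 1 :=
  ⟨fun _ => h.1 _, (hasSum_option_some h.2.2).2 h.2.1⟩

theorem muSeq_eq_succ_of_le (hα : 0 < α) (hconv : PowersConverge q D μ) {n : ℕ}
    (h : ∀ j, muSeq q D μ α (n + 1) (some j) = muSeq q D μ α n (some j)) (k : ℕ) (hk : n ≤ k) :
    muSeq q D μ α k = muSeq q D μ α (k + 1) := by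
  suffices h' : ∀ j, muSeq q D μ α (k + 1) (some j) = muSeq q D μ α k (some j) by
    funext i
    rcases i with _ | j
    · rfl
    · exact (h' j).symm
  induction k, hk using Nat.le_induction with
  | base => exact h
  | succ k _ ih =>
    intro j
    have h1 := muSeq_recurrence hα hconv (k + 1) j
    simp only [ih] at h1
    exact (mul_left_cancel₀ hα.ne' (neg_injective (h1.unique (muSeq_recurrence hα hconv k j))))

end Powers

end

/-! ### The theorem -/

theorem mainTheorem7 {S Ω : Type*} [Countable S] [MeasurableSpace Ω]
    (C : CTMarkovChain S Ω) (hirr : C.IsIrreducible)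
    (q : S → S → ℝ) (hq : C.IsQMatrix q) (hcons : ∀ i, HasSum (q i) 0)
    (D : Set S) (μ : CTMarkovChain.Killed D → ℝ) (hμ : IsDistribution μ)
    (hdiff : C.DiffCondition D μ)
    (α : ℝ) (hα : 0 < α) (hexp : C.IsExponential D μ α)
    (hconv : PowersConverge q D μ) :
    (∀ n : ℕ, 1 ≤ n →
      ((∀ m, 1 ≤ m → m < n → IsDistribution (muSeq q D μ α m)) ∨
        (∀ m, 1 ≤ m → PowerBounds q D μ α m)) →
      C.IsQuasiStationary D (muSeq q D μ α n) →
      ∀ k, n ≤ k → muSeq q D μ α k = muSeq q D μ α (k + 1)) ∧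
    (∀ μlim : CTMarkovChain.Killed D → ℝ,
      (∀ m, 1 ≤ m → IsDistribution (muSeq q D μ α m)) →
      (∀ i, Tendsto (fun n => muSeq q D μ α n i) atTop (𝓝 (μlim i))) →
      IsDistribution μlim →
      C.IsQuasiStationary D μlim) := by
  have hK := C.isMinimalKernel_subKernel hq D
  set ν : ℕ → {i : S // i ∉ D} → ℝ := fun n j => muSeq q D μ α n (some j) with hν_def
  have hs : ∀ n (j : {i : S // i ∉ D}), Summable fun i => ν n i * q i j := fun n j =>
    (muSeq_recurrence hα hconv n j).summable
  have hrec : ∀ n (j : {i : S // i ∉ D}), ∑' i, ν n i * q i j = -(α * ν (n + 1) j) := fun n j =>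
    (muSeq_recurrence hα hconv n j).tsum_eq
  have hν0 : ν 0 = fun j => μ (some j) := funext fun j => muSeq_zero j
  have hexp0 : ∀ t : ℝ≥0, ∑' i, ν 0 i * kernelMass (C.subKernel D) t i = Real.exp (-α * t) :=
    fun t => by rw [hν0, ← hexp t, C.survival_eq_tsum hμ.1]
  have hdist0 : (∀ i, 0 ≤ ν 0 i) ∧ HasSum (ν 0) 1 := by
    rw [hν0]
    exact hμ.some_nonneg_hasSum
  refine ⟨fun n hn hor hqs => ?_, fun μlim hdist hlim hlimd => ?_⟩
  · have hdistn := hqs.1.some_nonneg_hasSum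
    refine muSeq_eq_succ_of_le hα hconv ?_
    rcases hor with hdist | hbound
    · refine hK.succ_eq_of_distributions hα hs hrec hexp0 (n := n) (fun m hm => ?_) hqs.tsum_eq
      rcases Nat.eq_zero_or_pos m with rfl | hm0
      · exact hdist0
      · rcases hm.eq_or_lt with rfl | hlt
        · exact hdistn
        · exact (hdist m hm0 hlt).some_nonneg_hasSum
    -- The bounds are assumed from `m = 1` on; for `m = 0` they hold since `μ` is a distribution.
    · have hmem : ∀ m i, ν m i ∈ Icc (0 : ℝ) 1 := fun m i => by
        rcases Nat.eq_zero_or_pos m with rfl | hm0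
        · exact ⟨hdist0.1 i, le_hasSum hdist0.2 i fun j _ => hdist0.1 j⟩
        · exact (hbound m hm0).muSeq_mem_Icc hα i
      exact hK.succ_eq_of_bounded hα hs hrec hdist0.2 hexp0 (fun m i => (hmem m i).1)
        (fun m i => (hmem m i).2) hdistn.2 hqs.survival_pos hqs.tsum_eq
  · have hlimd' := hlimd.some_nonneg_hasSum
    obtain ⟨h1, h2⟩ := hK.vecMul_limit_eq hα hs hrec hexp0 (fun m => by
      rcases Nat.eq_zero_or_pos m with rfl | hm0
      · exact hdist0
      · exact (hdist m hm0).some_nonneg_hasSum) hlimd'.1 hlimd'.2 (fun i => hlim (some i))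
    refine ⟨hlimd, fun t i => ?_⟩
    cases i with
    | none => rw [C.condLaw_none, hlimd.2.2]
    | some j =>
      rw [C.condLaw_some hlimd.1, C.survival_eq_tsum hlimd.1, h1, h2,
        mul_div_cancel_left₀ _ (Real.exp_pos _).ne']
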